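/- For a function $F$ write $F^\sharp(z)=\overline{F(\bar z)}$, and let $\mathbb{C}_+=\{z:\Im z>0\}$. Let $c>0$, let $\mathcal{Z}\subset\{z: -c\le \Im z\le c\}$ be a discrete set (without accumulation points in $\mathbb{C}$), not containing $0$ and closed under $z\mapsto\bar z$ and $z\mapsto -z$, let $E$ be a function that is analytic and not identically zero on $\mathbb{C}\setminus\mathcal{Z}$, and let $K:\mathbb{R}\to\mathbb{R}$ be continuous. Assume * (K1) $E^\sharp(z)=E(-z)$ for $z\in\mathbb{C}\setminus\mathcal{Z}$; * (K2) $|K(x)|\ll e^{c|x|}$ as $|x|\to\infty$, and $E^\sharp(z)/E(z)=\int_{-\infty}^{\infty}K(x)e^{ixz}\,dx$ for $\Im z>c$ (as an identity of meromorphic functions); * (K3) $K(x)=0$ for $x<0$; * (K4) $K$ is continuously differentiable outside a discrete closed subset of $\mathbb{R}$, and $K'\in L^1_{\rm loc}(\mathbb{R})$; * (K5) with $\tau=\infty$: for every $t\ge 0$ neither $1$ nor $-1$ is an eigenvalue of the operator $\mathsf{K}[t]:f\mapsto \mathbf{1}_{(-\infty,t)}(x)\int_{-\infty}^{t}K(x+y)f(y)\,dy$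 on $L^2(-\infty,t)$. Then for every $t\in\mathbb{R}$ the following holds. The integral equations $$\Phi(t,x)+\int_{-\infty}^tK(x+y)\Phi(t,y)\,dy=1,\qquad \Psi(t,x)-\int_{-\infty}^tK(x+y)\Psi(t,y)\,dy=1\qquad(x\in\mathbb{R})$$ have unique locally integrable solutions $\Phi(t,\cdot)$, $\Psi(t,\cdot)$. The functions defined by $$A(t,z)=-\frac{iz}{2}E(z)\int_t^\infty\Psi(t,x)e^{izx}\,dx,\qquad -iB(t,z)=-\frac{iz}{2}E(z)\int_t^\infty\Phi(t,x)e^{izx}\,dx,$$ where the integrals converge absolutely for $\Im z>c$, continue analytically to $\mathbb{C}\setminus\mathcal{Z}$. Put $$E(t,z)=A(t,z)-iB(t,z),\qquad \Theta(t,z)=\frac{\overline{E(t,\bar z)}}{E(t,z)} .$$ Then $E(t,\cdot)$ is not identically zero on $\mathbb{C}_+\setminus\mathcal{Z}$, and $\Theta(t,\cdot)$ is an inner function in $\mathbb{C}_+$, removable singularities (at points of $\mathcal{Z}$ and at zeros of $E(t,\cdot)$) being removed: it extends to a bounded analytic function on $\mathbb{C}_+$ whose modulus satisfies $\lim_{y\to0+}|\Theta(t,x+iy)|=1$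 for almost every $x\in\mathbb{R}$. -/

import Mathlib

open MeasureTheory Set Filter Topology Asymptotics ComplexConjugate

noncomputable section

namespace InnerFamily

/-- `F^♯(z)`, the complex conjugate of the value of `F` at the conjugate point. -/
def sharp (F : ℂ → ℂ) (z : ℂ) : ℂ := conj (F (conj z))

/-- The Fourier integral `(F K)(z) = ∫ K(x) e^{ixz} dx` at a complex point. -/
def fourierIntegral (K : ℝ → ℝ) (z : ℂ) : ℂ :=
  ∫ x : ℝ, (K x : ℂ) * Complex.exp (Complex.I * x * z)

/-- Condition (K1), with its constant `c` and its set `Z` of possible singularities.  The values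
of `E` on `Z` play no role.  A discrete subset of the plane means one without accumulation points
in the plane, that is, a closed set with discrete induced topology. -/
structure CondK1 (E : ℂ → ℂ) (c : ℝ) (Z : Set ℂ) : Prop where
  c_pos : 0 < c
  isClosed : IsClosed Z
  isDiscrete : IsDiscrete Z
  zero_notMem : (0 : ℂ) ∉ Z
  strip : ∀ z ∈ Z, -c ≤ z.im ∧ z.im ≤ c
  conj_mem : ∀ z ∈ Z, conj z ∈ Z
  neg_mem : ∀ z ∈ Z, -z ∈ Z
  analytic : AnalyticOnNhd ℂ E Zᶜ
  sharp_eq : ∀ z ∉ Z, sharp E z = E (-z)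

/-- Condition (K2), with the constant `c` of (K1).  The quotient `E^♯ / E` is a quotient of
analytic functions with denominator not identically zero, so the identity is required at the
points where `E` does not vanish. -/
structure CondK2 (E : ℂ → ℂ) (c : ℝ) (Z : Set ℂ) (K : ℝ → ℝ) : Prop where
  continuous : Continuous K
  growth : K =O[cocompact ℝ] fun x : ℝ => Real.exp (c * |x|)
  ne_zero : ∃ z, z ∉ Z ∧ E z ≠ 0
  quotient_eq : ∀ z : ℂ, c < z.im → E z ≠ 0 → sharp E z / E z = fourierIntegral K z

/-- Condition (K3). -/
def CondK3 (K : ℝ → ℝ) : Prop := ∀ x : ℝ, x < 0 → K x = 0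

/-- Condition (K4). -/
def CondK4 (K : ℝ → ℝ) : Prop :=
  ∃ L : Set ℝ, IsClosed L ∧ IsDiscrete L ∧ ContDiffOn ℝ 1 K Lᶜ ∧
    LocallyIntegrable (deriv K) volume

/-- The operator `K[t]`, as an operation on functions. -/
def truncOp (K : ℝ → ℝ) (t : ℝ) (f : ℝ → ℂ) : ℝ → ℂ :=
  (Iio t).indicator fun x => ∫ y in Iio t, (K (x + y) : ℂ) * f y

/-- `μ` is an eigenvalue of `K[t]` on the complex Hilbert space `L²(-∞, t)`. -/
def IsEigenvalueTruncOp (K : ℝ → ℝ) (t : ℝ) (μ : ℂ) : Prop :=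
  ∃ f : ℝ → ℂ, MemLp f 2 (volume.restrict (Iio t)) ∧
    ¬ (f =ᵐ[volume.restrict (Iio t)] 0) ∧
    truncOp K t f =ᵐ[volume.restrict (Iio t)] fun x => μ * f x

/-- Condition (K5) for a given `τ ∈ (0, ∞]`. -/
def CondK5 (K : ℝ → ℝ) (τ : EReal) : Prop :=
  0 < τ ∧ ∀ t : ℝ, 0 ≤ t → (t : EReal) < τ →
    ¬ IsEigenvalueTruncOp K t 1 ∧ ¬ IsEigenvalueTruncOp K t (-1)

/-- `f` solves `f(x) + σ ∫_{-∞}^t K(x+y) f(y) dy = 1` for all real `x`.  For `σ = 1` this is the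
equation of `Φ(t, ·)`, for `σ = -1` the one of `Ψ(t, ·)`. -/
def SolvesIntegralEq (K : ℝ → ℝ) (σ : ℂ) (t : ℝ) (f : ℝ → ℂ) : Prop :=
  LocallyIntegrable f volume ∧
    ∀ x : ℝ, f x + σ * ∫ y in Iio t, (K (x + y) : ℂ) * f y = 1

/-- The function `-(iz/2) E(z) ∫_t^∞ f(x) e^{izx} dx`. -/
def halfLineTransform (E : ℂ → ℂ) (t : ℝ) (f : ℝ → ℂ) (z : ℂ) : ℂ :=
  -(Complex.I * z / 2) * E z * ∫ x in Ioi t, f x * Complex.exp (Complex.I * z * x)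

/-- `G` is an analytic continuation to `ℂ \ Z` of the function `g` on the half-plane `Im z > c`. -/
def IsContinuation (c : ℝ) (Z : Set ℂ) (g G : ℂ → ℂ) : Prop :=
  AnalyticOnNhd ℂ G Zᶜ ∧ ∀ z : ℂ, c < z.im → G z = g z

/-- `θ` is an inner function in the upper half-plane. -/
structure IsInnerFunction (θ : ℂ → ℂ) : Prop where
  analytic : AnalyticOnNhd ℂ θ {z : ℂ | 0 < z.im}
  bounded : ∃ C : ℝ, ∀ z : ℂ, 0 < z.im → ‖θ z‖ ≤ C
  boundary : ∀ᵐ x : ℝ, Tendsto (fun y : ℝ => ‖θ (x + y * Complex.I)‖) (𝓝[>] 0) (𝓝 1)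

/-- The quotient `F^♯ / F`, for `F` analytic outside `Z`, is an inner function in the upper
half-plane: `F` is not identically zero there, and outside `Z` and the zeros of `F` the quotient
agrees with an inner function. -/
def IsInnerQuotient (Z : Set ℂ) (F : ℂ → ℂ) : Prop :=
  (∃ z : ℂ, 0 < z.im ∧ z ∉ Z ∧ F z ≠ 0) ∧
    ∃ θ : ℂ → ℂ, IsInnerFunction θ ∧
      ∀ z : ℂ, 0 < z.im → z ∉ Z → F z ≠ 0 → sharp F z / F z = θ z

end InnerFamily

end

noncomputable section

namespace InnerFamily

/-! The argument turns the spectral condition (K5) into a contraction and then works with a transfer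
matrix of determinant one.

Contraction. Since `K` vanishes on the negative axis, the truncated Hankel operator lives on a
bounded interval, where it is compact and symmetric. Its norm depends continuously on `t` and is `0`
at `t = 0`. A compact symmetric operator of norm `1` has `1` or `-1` as an eigenvalue, so the norm
can never reach `1` (`norm_kernelOp_truncKernel_lt_one`). Consequently the Hankel operator contracts
`L²`, and since it becomes multiplication by the Fourier integral of `K`, that integral extends to
an analytic `Θ` with `‖Θ‖ ≤ 1` on the upper half-plane (`exists_schur_extension`). The identity
theorem gives `E(z) Θ(z) = E(-z)`, so `Θ` has unimodular limits at all real points off a countable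
set.

Solutions. Differentiating the integral equation in `x` and integrating by parts gives an equation
for `φ = Φ'/Φ(t)` in which only `K` occurs, and it is solvable by a Neumann series. The primitive of
`φ` solves the original equation with a constant `C` on the right, so dividing by `C` gives the
solution once `C ≠ 0`. With `q` the transform `edge`, the half-line transform of the solution is
`E/2` times `(q(z) - σ Θ(z) q(-z)) / C`; rewriting `E Θ` as `E(-z)` continues it analytically to the
complement of `Z`.

Determinant. For the densities of the two signs, `q₁(z) q₂(-z) + q₁(-z) q₂(z)` is entire, even and
bounded, and tends to `2` along the imaginary axis, so it equals `2` (`edge_mul_edge_add`). At `z =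
0` this says `C₁ C₂ = 1`, which supplies `C ≠ 0`.

Inner function. Put `p = q₂(z) + Θ q₂(-z)` and `m = q₁(z) - Θ q₁(-z)`. A boundary maximum principle,
applied to a bounded function built from `p`, `m` and the determinant identity, yields `Re (p m̄) ≥
0` (`re_mul_conj_nonneg`). The quotient in question is `(p/C₂ - m/C₁) / (p/C₂ + m/C₁)`, a Cayley
transform, hence bounded by `1`. At the boundary `p m̄` is purely imaginary, so the modulus there is
`1`. -/

theorem norm_sq_integral_mul_le {μ : Measure ℝ} {f g : ℝ → ℂ} (hf : MemLp f 2 μ) (hg : MemLp g 2 μ) :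
    ‖∫ y, f y * g y ∂μ‖ ^ 2 ≤ (∫ y, ‖f y‖ ^ 2 ∂μ) * ∫ y, ‖g y‖ ^ 2 ∂μ := by
  have h := integral_mul_norm_le_Lp_mul_Lq (μ := μ) (f := f) (g := g) (p := 2) (q := 2)
    Real.HolderConjugate.two_two (by simpa using hf) (by simpa using hg)
  have h1 : ‖∫ y, f y * g y ∂μ‖ ≤ ∫ y, ‖f y‖ * ‖g y‖ ∂μ := by
    simpa using norm_integral_le_integral_norm (μ := μ) (fun y => f y * g y)
  simp only [Real.rpow_two] at h
  rw [← Real.sqrt_eq_rpow, ← Real.sqrt_eq_rpow] at h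
  have h0 : 0 ≤ ∫ y, ‖f y‖ ^ 2 ∂μ := integral_nonneg fun _ => by positivity
  have h0' : 0 ≤ ∫ y, ‖g y‖ ^ 2 ∂μ := integral_nonneg fun _ => by positivity
  calc _ ≤ (√(∫ y, ‖f y‖ ^ 2 ∂μ) * √(∫ y, ‖g y‖ ^ 2 ∂μ)) ^ 2 := by
        gcongr; exact h1.trans h
    _ = _ := by rw [mul_pow, Real.sq_sqrt h0, Real.sq_sqrt h0']

theorem Lp_norm_sq_eq {μ : Measure ℝ} (f : Lp ℂ 2 μ) : ‖f‖ ^ 2 = ∫ x, ‖f x‖ ^ 2 ∂μ := by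
  have := L2.inner_def (𝕜 := ℂ) f f
  rw [inner_self_eq_norm_sq_to_K] at this
  have h2 : ∀ x, inner ℂ (f x) (f x) = ((‖f x‖ ^ 2 : ℝ) : ℂ) := fun x => by
    rw [inner_self_eq_norm_sq_to_K]; simp
  simp_rw [h2] at this
  rw [integral_complex_ofReal] at this
  exact Complex.ofReal_injective (by simpa using this)

/-! ### Hilbert–Schmidt operators with bounded kernels -/

section KernelOperator

variable {μ : Measure ℝ} [IsFiniteMeasure μ] {k k' : ℝ → ℝ → ℂ} {M M' : ℝ}

theorem memLp_two_of_bound {f : ℝ → ℂ} (hf : Measurable f) (hb : ∀ x, ‖f x‖ ≤ M) :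
    MemLp f 2 μ :=
  MemLp.of_bound hf.aestronglyMeasurable M (ae_of_all _ hb)

theorem norm_sq_kernel_integral_le (hk : Measurable (Function.uncurry k))
    (hb : ∀ x y, ‖k x y‖ ≤ M) (f : Lp ℂ 2 μ) (x : ℝ) :
    ‖∫ y, k x y * f y ∂μ‖ ^ 2 ≤ (∫ y, ‖k x y‖ ^ 2 ∂μ) * ‖f‖ ^ 2 := by
  rw [Lp_norm_sq_eq]
  exact norm_sq_integral_mul_le
    (memLp_two_of_bound (hk.comp (measurable_const.prodMk measurable_id)) (hb x)) (Lp.memLp f)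

theorem integrable_norm_sq_kernel (hk : Measurable (Function.uncurry k))
    (hb : ∀ x y, ‖k x y‖ ≤ M) :
    Integrable (fun p : ℝ × ℝ => ‖k p.1 p.2‖ ^ 2) (μ.prod μ) := by
  refine Integrable.of_bound (C := M ^ 2) (hk.norm.pow_const 2).aestronglyMeasurable
    (ae_of_all _ fun p => ?_)
  rw [Real.norm_of_nonneg (by positivity)]
  gcongr; exact hb _ _

theorem memLp_kernel_integral (hk : Measurable (Function.uncurry k))
    (hb : ∀ x y, ‖k x y‖ ≤ M) (f : Lp ℂ 2 μ) :
    MemLp (fun x => ∫ y, k x y * f y ∂μ) 2 μ := by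
  have hM : 0 ≤ M := (norm_nonneg _).trans (hb 0 0)
  have hm : StronglyMeasurable fun x => ∫ y, k x y * f y ∂μ :=
    StronglyMeasurable.integral_prod_right (f := fun x y => k x y * f y)
      (hk.stronglyMeasurable.mul ((Lp.stronglyMeasurable f).comp_measurable measurable_snd))
  refine MemLp.of_bound hm.aestronglyMeasurable (M * ∫ y, ‖f y‖ ∂μ) (ae_of_all _ fun x => ?_)
  rw [← integral_const_mul]
  refine norm_integral_le_of_norm_le
    (((Lp.memLp f).integrable (by norm_num)).norm.const_mul M) (ae_of_all _ fun y => ?_)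
  rw [norm_mul]; gcongr; exact hb x y

theorem integrable_kernel_mul (hk : Measurable (Function.uncurry k))
    (hb : ∀ x y, ‖k x y‖ ≤ M) (f : Lp ℂ 2 μ) (x : ℝ) :
    Integrable (fun y => k x y * f y) μ :=
  ((Lp.memLp f).integrable (by norm_num)).bdd_mul (c := M)
    (hk.comp (measurable_const.prodMk measurable_id)).aestronglyMeasurable (ae_of_all _ (hb x))

/-- The integral operator on `L²(μ)` with a bounded measurable kernel. -/
def kernelOp (μ : Measure ℝ) [IsFiniteMeasure μ] (hk : Measurable (Function.uncurry k))
    (hb : ∀ x y, ‖k x y‖ ≤ M) : Lp ℂ 2 μ →L[ℂ] Lp ℂ 2 μ :=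
  LinearMap.mkContinuous
    { toFun := fun f => (memLp_kernel_integral hk hb f).toLp
      map_add' := fun f g => by
        rw [← MemLp.toLp_add]
        refine MemLp.toLp_congr _ _ (ae_of_all _ fun x => ?_)
        simp only [Pi.add_apply]
        rw [← integral_add (integrable_kernel_mul hk hb f x) (integrable_kernel_mul hk hb g x)]
        refine integral_congr_ae ?_
        filter_upwards [Lp.coeFn_add f g] with y hy
        rw [hy, Pi.add_apply, mul_add]
      map_smul' := fun c f => by
        rw [RingHom.id_apply, ← MemLp.toLp_const_smul]
        refine MemLp.toLp_congr _ _ (ae_of_all _ fun x => ?_)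
        simp only [Pi.smul_apply, smul_eq_mul]
        rw [← integral_const_mul]
        refine integral_congr_ae ?_
        filter_upwards [Lp.coeFn_smul c f] with y hy
        rw [hy, Pi.smul_apply, smul_eq_mul]; ring }
    (√(∫ p : ℝ × ℝ, ‖k p.1 p.2‖ ^ 2 ∂μ.prod μ)) (fun f => by
      have h0 : 0 ≤ ∫ p : ℝ × ℝ, ‖k p.1 p.2‖ ^ 2 ∂μ.prod μ :=
        integral_nonneg fun _ => by positivity
      refine le_of_sq_le_sq ?_ (by positivity)
      rw [mul_pow, Real.sq_sqrt h0, Lp_norm_sq_eq]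
      have hI := integrable_norm_sq_kernel (μ := μ) hk hb
      rw [integral_prod _ hI, ← integral_mul_const]
      refine (integral_congr_ae ?_).trans_le
        (integral_mono_of_nonneg (f := fun x => ‖∫ y, k x y * f y ∂μ‖ ^ 2)
          (ae_of_all _ fun x => by positivity)
          (hI.integral_prod_left.mul_const _)
          (ae_of_all _ fun x => norm_sq_kernel_integral_le hk hb f x))
      filter_upwards [(memLp_kernel_integral hk hb f).coeFn_toLp] with x hx
      simp only [LinearMap.coe_mk, AddHom.coe_mk]
      rw [hx])

theorem kernelOp_coeFn (hk : Measurable (Function.uncurry k)) (hb : ∀ x y, ‖k x y‖ ≤ M)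
    (f : Lp ℂ 2 μ) : kernelOp μ hk hb f =ᵐ[μ] fun x => ∫ y, k x y * f y ∂μ :=
  (memLp_kernel_integral hk hb f).coeFn_toLp

theorem norm_kernelOp_le (hk : Measurable (Function.uncurry k)) (hb : ∀ x y, ‖k x y‖ ≤ M) :
    ‖kernelOp μ hk hb‖ ≤ √(∫ p : ℝ × ℝ, ‖k p.1 p.2‖ ^ 2 ∂μ.prod μ) :=
  LinearMap.mkContinuous_norm_le _ (Real.sqrt_nonneg _) _

theorem norm_sub_le_add_of_bounds (hb : ∀ x y, ‖k x y‖ ≤ M) (hb' : ∀ x y, ‖k' x y‖ ≤ M')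
    (x y : ℝ) : ‖k x y - k' x y‖ ≤ M + M' :=
  (norm_sub_le _ _).trans (add_le_add (hb x y) (hb' x y))

theorem kernelOp_sub (hk : Measurable (Function.uncurry k)) (hb : ∀ x y, ‖k x y‖ ≤ M)
    (hk' : Measurable (Function.uncurry k')) (hb' : ∀ x y, ‖k' x y‖ ≤ M') :
    kernelOp μ hk hb - kernelOp μ hk' hb' =
      kernelOp μ (k := fun x y => k x y - k' x y) (hk.sub hk')
        (norm_sub_le_add_of_bounds hb hb') := by
  ext1 f
  refine Lp.ext ?_
  rw [sub_apply]
  filter_upwards [Lp.coeFn_sub (kernelOp μ hk hb f) (kernelOp μ hk' hb' f),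
    kernelOp_coeFn hk hb f, kernelOp_coeFn hk' hb' f,
    kernelOp_coeFn (k := fun x y => k x y - k' x y) (hk.sub hk')
        (norm_sub_le_add_of_bounds hb hb') f] with x h1 h2 h3 h4
  rw [h1, Pi.sub_apply, h2, h3, h4, ← integral_sub (integrable_kernel_mul hk hb f x)
    (integrable_kernel_mul hk' hb' f x)]
  simp only [sub_mul]

/-- The Hilbert–Schmidt norm dominates the operator norm, and on a finite measure space dominated
convergence makes it tend to zero. -/
theorem tendsto_kernelOp {ι : Type*} {l : Filter ι} [l.IsCountablyGenerated]
    {κ : ι → ℝ → ℝ → ℂ}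
    (hκ : ∀ i, Measurable (Function.uncurry (κ i))) (hbκ : ∀ i x y, ‖κ i x y‖ ≤ M)
    (hk : Measurable (Function.uncurry k)) (hb : ∀ x y, ‖k x y‖ ≤ M)
    (h : ∀ᵐ p : ℝ × ℝ ∂μ.prod μ, Tendsto (fun i => κ i p.1 p.2) l (𝓝 (k p.1 p.2))) :
    Tendsto (fun i => kernelOp μ (hκ i) (hbκ i)) l (𝓝 (kernelOp μ hk hb)) := by
  rw [tendsto_iff_norm_sub_tendsto_zero]
  have key : Tendsto (fun i => ∫ p : ℝ × ℝ, ‖κ i p.1 p.2 - k p.1 p.2‖ ^ 2 ∂μ.prod μ) l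
      (𝓝 (∫ p : ℝ × ℝ, (0 : ℝ) ∂μ.prod μ)) := by
    refine tendsto_integral_filter_of_dominated_convergence (fun _ => (M + M) ^ 2)
      (Eventually.of_forall fun i =>
        (((hκ i).sub hk).norm.pow_const 2).aestronglyMeasurable)
      (Eventually.of_forall fun i => ae_of_all _ fun p => ?_) (integrable_const _) ?_
    · rw [Real.norm_of_nonneg (by positivity)]
      gcongr
      exact norm_sub_le_add_of_bounds (hbκ i) hb _ _
    · filter_upwards [h] with p hp
      have := ((hp.sub_const (k p.1 p.2)).norm.pow 2)
      simpa using this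
  have key2 := (Real.continuous_sqrt.tendsto _).comp key
  simp only [integral_zero, Real.sqrt_zero] at key2
  refine squeeze_zero (fun _ => norm_nonneg _) (fun i => ?_) key2
  rw [kernelOp_sub]
  exact norm_kernelOp_le _ _

theorem isSymmetric_kernelOp (hk : Measurable (Function.uncurry k)) (hb : ∀ x y, ‖k x y‖ ≤ M)
    (hs : ∀ x y, conj (k x y) = k y x) :
    (kernelOp μ hk hb : Lp ℂ 2 μ →ₗ[ℂ] Lp ℂ 2 μ).IsSymmetric := by
  intro f g
  simp only [ContinuousLinearMap.coe_coe]
  rw [L2.inner_def, L2.inner_def]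
  have hf := (Lp.memLp f).integrable (by norm_num)
  have hg := (Lp.memLp g).integrable (by norm_num)
  have hfc : Integrable (fun y => conj (f y)) μ := by
    simpa using (Complex.conjCLE.toContinuousLinearMap.integrable_comp hf)
  have e1 : ∫ x, inner ℂ (kernelOp μ hk hb f x) (g x) ∂μ
      = ∫ x, ∫ y, k y x * (g x * conj (f y)) ∂μ ∂μ := by
    refine integral_congr_ae ?_
    filter_upwards [kernelOp_coeFn hk hb f] with x hx
    rw [hx, RCLike.inner_apply, ← integral_conj, ← integral_const_mul]
    refine integral_congr_ae (ae_of_all _ fun y => ?_)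
    simp only [map_mul, hs]; ring
  have e2 : ∫ y, inner ℂ (f y) (kernelOp μ hk hb g y) ∂μ
      = ∫ y, ∫ x, k y x * (g x * conj (f y)) ∂μ ∂μ := by
    refine integral_congr_ae ?_
    filter_upwards [kernelOp_coeFn hk hb g] with x hx
    rw [hx, RCLike.inner_apply, ← integral_mul_const]
    refine integral_congr_ae (ae_of_all _ fun y => ?_)
    simp only; ring
  rw [e1, e2]
  refine integral_integral_swap (f := fun x y => k y x * (g x * conj (f y))) ?_
  refine (hg.mul_prod hfc).bdd_mul (c := M)
    (hk.comp measurable_swap).aestronglyMeasurable (ae_of_all _ fun p => hb _ _)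

/-- A product kernel gives the rank-one operator `f ↦ ⟨b̄, f⟩ a`. -/
theorem isCompactOperator_kernelOp_mul {a b : ℝ → ℂ} (ha : Measurable a) (hbd : Measurable b)
    {A B : ℝ} (hA : ∀ x, ‖a x‖ ≤ A) (hB : ∀ x, ‖b x‖ ≤ B)
    (hk : Measurable (Function.uncurry fun x y => a x * b y))
    (hb : ∀ x y, ‖a x * b y‖ ≤ M) : IsCompactOperator (kernelOp μ hk hb) := by
  have hbc : MemLp (fun y => conj (b y)) 2 μ :=
    memLp_two_of_bound (Complex.continuous_conj.measurable.comp hbd) (M := B) (by simpa using hB)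
  have haL : MemLp a 2 μ := memLp_two_of_bound ha hA
  have : kernelOp μ hk hb = (ContinuousLinearMap.toSpanSingleton ℂ haL.toLp).comp
      (innerSL ℂ hbc.toLp) := by
    ext1 f
    refine Lp.ext ?_
    simp only [ContinuousLinearMap.comp_apply, ContinuousLinearMap.toSpanSingleton_apply,
      innerSL_apply_apply]
    filter_upwards [kernelOp_coeFn hk hb f, Lp.coeFn_smul (inner ℂ hbc.toLp f) haL.toLp,
      haL.coeFn_toLp] with x h1 h2 h3
    rw [h1, h2, Pi.smul_apply, h3, L2.inner_def, smul_eq_mul, ← integral_mul_const]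
    refine integral_congr_ae ?_
    filter_upwards [hbc.coeFn_toLp] with y hy
    rw [hy, RCLike.inner_apply]; simp; ring
  rw [this]
  exact (isCompactOperator_of_locallyCompactSpace_rng
    (ContinuousLinearMap.toSpanSingleton ℂ haL.toLp)).comp_clm (innerSL ℂ hbc.toLp)

theorem isCompactOperator_kernelOp_sum {ι : Type*} (s : Finset ι) {a b : ι → ℝ → ℂ}
    (ha : ∀ i, Measurable (a i)) (hbd : ∀ i, Measurable (b i)) {A B : ℝ}
    (hA : ∀ i x, ‖a i x‖ ≤ A) (hB : ∀ i x, ‖b i x‖ ≤ B)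
    (hk : Measurable (Function.uncurry fun x y => ∑ i ∈ s, a i x * b i y))
    (hb : ∀ x y, ‖∑ i ∈ s, a i x * b i y‖ ≤ M) : IsCompactOperator (kernelOp μ hk hb) := by
  classical
  induction s using Finset.induction_on generalizing M with
  | empty =>
    have : kernelOp μ hk hb = 0 := by
      ext1 f
      refine Lp.ext ?_
      filter_upwards [kernelOp_coeFn hk hb f, Lp.coeFn_zero ℂ 2 μ] with x h1 h2
      rw [h1, zero_apply, h2]; simp
    rw [this]; exact isCompactOperator_zero
  | insert i s hi ih =>
    have hm : ∀ j, Measurable (Function.uncurry fun x y => a j x * b j y) := fun j =>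
      ((ha j).comp measurable_fst).mul ((hbd j).comp measurable_snd)
    have hA0 : ∀ j, 0 ≤ A := fun j => (norm_nonneg _).trans (hA j 0)
    have hbj : ∀ j x y, ‖a j x * b j y‖ ≤ A * B := fun j x y => by
      rw [norm_mul]; exact mul_le_mul (hA j x) (hB j y) (norm_nonneg _) (hA0 j)
    have hms : Measurable (Function.uncurry fun x y => ∑ j ∈ s, a j x * b j y) :=
      Finset.measurable_sum s fun j _ => hm j
    -- `M` bounds only the full sum; dropping one term costs at most `A * B`, which is why the
    -- induction generalizes over `M`.
    have hbs : ∀ x y, ‖∑ j ∈ s, a j x * b j y‖ ≤ M + A * B := fun x y => by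
      have h1 := hb x y
      rw [Finset.sum_insert hi] at h1
      have h2 := norm_sub_le (a i x * b i y + ∑ j ∈ s, a j x * b j y) (a i x * b i y)
      rw [add_sub_cancel_left] at h2
      linarith [hbj i x y]
    have := kernelOp_sub (μ := μ) hk hb hms hbs
    have h2 : kernelOp μ hk hb - kernelOp μ hms hbs =
        kernelOp μ (k := fun x y => a i x * b i y) (hm i) (hbj i) := by
      rw [this]
      ext1 f
      refine Lp.ext ?_
      refine (kernelOp_coeFn _ _ f).trans (EventuallyEq.trans ?_ (kernelOp_coeFn _ _ f).symm)
      refine ae_of_all _ fun x => integral_congr_ae (ae_of_all _ fun y => ?_)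
      simp only
      rw [Finset.sum_insert hi]; ring
    rw [sub_eq_iff_eq_add] at h2
    rw [h2]
    exact (isCompactOperator_kernelOp_mul (ha i) (hbd i) (hA i) (hB i) _ _).add (ih hms hbs)

end KernelOperator

/-- If neither `1` nor `-1` were an eigenvalue, compactness would put both in the resolvent set, and
the Rayleigh quotients would stay strictly below `‖T‖` in modulus. For a symmetric operator their
supremum is `‖T‖`. -/
theorem exists_eigenvalue_of_norm_eq_one {H : Type*} [NormedAddCommGroup H]
    [InnerProductSpace ℂ H] [CompleteSpace H] {T : H →L[ℂ] H} (hc : IsCompactOperator T)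
    (hs : (T : H →ₗ[ℂ] H).IsSymmetric) (h1 : ‖T‖ = 1) :
    ∃ μ : ℂ, (μ = 1 ∨ μ = -1) ∧ ∃ v : H, v ≠ 0 ∧ T v = μ • v := by
  have : Nontrivial H := by
    by_contra hn
    rw [not_nontrivial_iff_subsingleton] at hn
    have : T = 0 := by ext x; exact Subsingleton.elim _ _
    rw [this, norm_zero] at h1
    norm_num at h1
  have aux : ∀ μ : ℂ, μ ≠ 0 → μ ∉ resolventSet ℂ T → ∃ v : H, v ≠ 0 ∧ T v = μ • v := by
    intro μ hμ hr
    obtain ⟨v, hv⟩ := ((hc.hasEigenvalue_or_mem_resolventSet hμ).resolve_right hr).exists_hasEigenvector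
    exact ⟨v, hv.2, hv.apply_eq_smul⟩
  by_contra! hcon
  have r1 : algebraMap ℝ ℂ ‖T‖ ∈ resolventSet ℂ T := by
    by_contra hr
    rw [h1, map_one] at hr
    obtain ⟨v, hv, hv'⟩ := aux 1 one_ne_zero hr
    exact hcon 1 (Or.inl rfl) v hv hv'
  have r2 : -algebraMap ℝ ℂ ‖T‖ ∈ resolventSet ℂ T := by
    by_contra hr
    rw [h1, map_one] at hr
    obtain ⟨v, hv, hv'⟩ := aux (-1) (by norm_num) hr
    exact hcon (-1) (Or.inr rfl) v hv hv'
  obtain ⟨c, hc0, hc⟩ := T.abs_rayleighQuotient_le_of_norm_mem_resolventSet r1 r2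
  have := ciSup_le hc
  rw [← T.norm_eq_iSup_rayleighQuotient hs] at this
  linarith

/-- The nearest point of `[-R, R]`. -/
def clip (R x : ℝ) : ℝ := max (-R) (min R x)

theorem continuous_clip (R : ℝ) : Continuous (clip R) := by
  unfold clip; fun_prop

theorem abs_clip_le {R : ℝ} (hR : 0 ≤ R) (x : ℝ) : |clip R x| ≤ R := by
  unfold clip
  rw [abs_le]
  exact ⟨le_max_left _ _, max_le (by linarith) (min_le_left _ _)⟩

theorem clip_of_mem {R x : ℝ} (hx : x ∈ Icc (-R) R) : clip R x = x := by
  unfold clip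
  rw [min_eq_right hx.2, max_eq_right hx.1]

theorem exists_bound_on_interval {K : ℝ → ℝ} (hK : Continuous K) (R : ℝ) :
    ∃ M : ℝ, ∀ u : ℝ, |u| ≤ R → |K u| ≤ M := by
  obtain ⟨M, hM⟩ := (isCompact_Icc (a := -R) (b := R)).exists_bound_of_continuousOn hK.continuousOn
  exact ⟨M, fun u hu => hM u (abs_le.1 hu)⟩

theorem continuous_integral_translate {K : ℝ → ℝ} (hK : Continuous K) {f : ℝ → ℂ} {a b : ℝ}
    (hf : IntegrableOn f (Icc a b)) :
    Continuous fun x : ℝ => ∫ y in Icc a b, (K (x + y) : ℂ) * f y := by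
  rw [continuous_iff_continuousAt]
  intro x₀
  obtain ⟨M, hM⟩ := exists_bound_on_interval hK (|x₀| + 1 + (|a| + |b|))
  refine continuousAt_of_dominated (bound := fun y => M * ‖f y‖)
    (Eventually.of_forall fun x => ?_) ?_ (hf.norm.const_mul M) ?_
  · exact ((Complex.continuous_ofReal.comp
      (hK.comp (continuous_const.add continuous_id))).aestronglyMeasurable).mul hf.1
  · filter_upwards [Metric.ball_mem_nhds x₀ one_pos] with x hx
    refine (ae_restrict_iff' measurableSet_Icc).2 (ae_of_all _ fun y hy => ?_)
    rw [norm_mul, Complex.norm_real]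
    refine mul_le_mul_of_nonneg_right (hM _ ?_) (norm_nonneg _)
    rw [Metric.mem_ball, Real.dist_eq] at hx
    have h1 : |x + y| ≤ |x| + |y| := abs_add_le _ _
    have h2 : |x| ≤ |x - x₀| + |x₀| := by
      simpa using abs_add_le (x - x₀) x₀
    have h3 : |y| ≤ |a| + |b| := by
      rw [abs_le]
      constructor
      · linarith [neg_abs_le a, abs_nonneg b, hy.1]
      · linarith [le_abs_self b, abs_nonneg a, hy.2]
    linarith
  · refine ae_of_all _ fun y => ?_
    exact ((Complex.continuous_ofReal.comp (hK.comp (continuous_id.add continuous_const))).mul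
      continuous_const).continuousAt

/-- The kernel of the truncated operator, cut off outside `[-R, R]`. -/
def truncKernel (K : ℝ → ℝ) (R t x y : ℝ) : ℂ :=
  if x < t ∧ y < t then (K (clip R x + clip R y) : ℂ) else 0

/-! ### The truncated Hankel operator has norm below one -/

section Trunc

variable {K : ℝ → ℝ} {R M : ℝ}

theorem measurable_truncKernel (hK : Continuous K) (t : ℝ) :
    Measurable (Function.uncurry (truncKernel K R t)) := by
  refine Measurable.ite ?_ ?_ measurable_const
  · exact (measurableSet_lt measurable_fst measurable_const).inter
      (measurableSet_lt measurable_snd measurable_const)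
  · exact (Complex.continuous_ofReal.comp (hK.comp (((continuous_clip R).comp continuous_fst).add
      ((continuous_clip R).comp continuous_snd)))).measurable

theorem norm_truncKernel_le (hR : 0 ≤ R) (hM : ∀ u, |u| ≤ 2 * R → |K u| ≤ M) (t x y : ℝ) :
    ‖truncKernel K R t x y‖ ≤ M := by
  unfold truncKernel
  split_ifs
  · rw [Complex.norm_real]
    refine hM _ ((abs_add_le _ _).trans ?_)
    linarith [abs_clip_le hR x, abs_clip_le hR y]
  · rw [norm_zero]
    exact (abs_nonneg _).trans (hM 0 (by simpa using hR))

theorem conj_truncKernel (t x y : ℝ) :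
    conj (truncKernel K R t x y) = truncKernel K R t y x := by
  unfold truncKernel
  simp only [apply_ite conj, Complex.conj_ofReal, map_zero, and_comm, add_comm]

theorem ae_ne_restrict (s : Set ℝ) (t : ℝ) : ∀ᵐ x ∂(volume.restrict s : Measure ℝ), x ≠ t :=
  ae_restrict_of_ae (by simp [ae_iff])

/-- As a function of the truncation point the kernel can jump only on the lines `x = t` and `y = t`,
which are null sets. -/
theorem tendsto_truncKernel (t : ℝ) :
    ∀ᵐ p : ℝ × ℝ ∂((volume.restrict (Icc (-R) R)).prod (volume.restrict (Icc (-R) R))),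
      Tendsto (fun s => truncKernel K R s p.1 p.2) (𝓝 t) (𝓝 (truncKernel K R t p.1 p.2)) := by
  filter_upwards [Measure.quasiMeasurePreserving_fst.ae (ae_ne_restrict (Icc (-R) R) t),
    Measure.quasiMeasurePreserving_snd.ae (ae_ne_restrict (Icc (-R) R) t)] with p h1 h2
  have aux : ∀ u : ℝ, u ≠ t → ∀ᶠ s in 𝓝 t, (u < s ↔ u < t) := by
    intro u hu
    rcases lt_or_gt_of_ne hu with h | h
    · filter_upwards [lt_mem_nhds h] with s hs
      exact ⟨fun _ => h, fun _ => hs⟩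
    · filter_upwards [gt_mem_nhds h] with s hs
      exact ⟨fun h' => absurd h' hs.not_gt, fun h' => absurd h' h.not_gt⟩
  refine tendsto_const_nhds.congr' ?_
  filter_upwards [aux _ h1, aux _ h2] with s hs1 hs2
  unfold truncKernel
  simp only [hs1, hs2]

theorem abs_floor_div_sub_le (n : ℕ) (u : ℝ) :
    |(⌊((n : ℝ) + 1) * u⌋ : ℝ) / ((n : ℝ) + 1) - u| ≤ 1 / ((n : ℝ) + 1) := by
  have hn : (0 : ℝ) < n + 1 := by positivity
  have h1 := Int.floor_le (((n : ℝ) + 1) * u)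
  have h2 := Int.lt_floor_add_one (((n : ℝ) + 1) * u)
  have : (⌊((n : ℝ) + 1) * u⌋ : ℝ) / ((n : ℝ) + 1) - u =
      ((⌊((n : ℝ) + 1) * u⌋ : ℝ) - ((n : ℝ) + 1) * u) / ((n : ℝ) + 1) := by
    field_simp
  rw [this, abs_div, abs_of_pos hn]
  gcongr
  rw [abs_le]; constructor <;> linarith

/-- Rounding the first variable down to the grid of step `1/(n+1)` makes the kernel a finite sum of
products, so the operator has finite rank. These operators converge in norm by continuity of `K`. -/
theorem isCompactOperator_truncKernel (hK : Continuous K) (hR : 0 ≤ R)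
    (hM : ∀ u, |u| ≤ 2 * R → |K u| ≤ M) (t : ℝ) :
    IsCompactOperator (kernelOp (volume.restrict (Icc (-R) R)) (measurable_truncKernel (R := R) hK t)
      (norm_truncKernel_le hR hM t)) := by
  let a : ℕ → ℤ → ℝ → ℂ := fun n j x => if x < t ∧ ⌊((n : ℝ) + 1) * clip R x⌋ = j then 1 else 0
  let b : ℕ → ℤ → ℝ → ℂ := fun n j y =>
    if y < t then (K (clip R ((j : ℝ) / ((n : ℝ) + 1)) + clip R y) : ℂ) else 0
  -- All values of the floor that occur, because `clip R x` stays in `[-R, R]`.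
  let S : ℕ → Finset ℤ := fun n => Finset.Icc (⌊-(((n : ℝ) + 1) * R)⌋) (⌊((n : ℝ) + 1) * R⌋)
  let κ : ℕ → ℝ → ℝ → ℂ := fun n x y => ∑ j ∈ S n, a n j x * b n j y
  have hκeq : ∀ n x y, κ n x y = if x < t ∧ y < t then
      (K (clip R ((⌊((n : ℝ) + 1) * clip R x⌋ : ℝ) / ((n : ℝ) + 1)) + clip R y) : ℂ) else 0 := by
    intro n x y
    have hmem : ⌊((n : ℝ) + 1) * clip R x⌋ ∈ S n := by
      have h := abs_le.1 (abs_clip_le hR x)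
      refine Finset.mem_Icc.2 ⟨Int.floor_le_floor ?_, Int.floor_le_floor ?_⟩
      · rw [← mul_neg]; gcongr; exact h.1
      · gcongr; exact h.2
    simp only [κ]
    rw [Finset.sum_eq_single_of_mem _ hmem]
    · simp only [a, b]
      by_cases h1 : x < t <;> by_cases h2 : y < t <;> simp [h1, h2]
    · intro j _ hj
      simp [a, Ne.symm hj]
  have ha : ∀ n j, Measurable (a n j) := fun n j => by
    refine Measurable.ite ((measurableSet_lt measurable_id measurable_const).inter ?_)
      measurable_const measurable_const
    exact (Int.measurable_floor.comp
      (measurable_const.mul (continuous_clip R).measurable)) (measurableSet_singleton j)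
  have hbm : ∀ n j, Measurable (b n j) := fun n j => by
    refine Measurable.ite (measurableSet_lt measurable_id measurable_const) ?_ measurable_const
    exact (Complex.continuous_ofReal.comp
      (hK.comp (continuous_const.add (continuous_clip R)))).measurable
  have hM0 : 0 ≤ M := (abs_nonneg _).trans (hM 0 (by simpa using hR))
  have hclip : ∀ u v : ℝ, ‖(K (clip R u + clip R v) : ℂ)‖ ≤ M := fun u v => by
    rw [Complex.norm_real]
    refine hM _ ((abs_add_le _ _).trans ?_)
    linarith [abs_clip_le hR u, abs_clip_le hR v]
  have hA : ∀ n j x, ‖a n j x‖ ≤ 1 := fun n j x => by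
    simp only [a]; split_ifs <;> simp
  have hB : ∀ n j y, ‖b n j y‖ ≤ M := fun n j y => by
    simp only [b]; split_ifs
    · exact hclip _ _
    · simpa using hM0
  have hκm : ∀ n, Measurable (Function.uncurry (κ n)) := fun n =>
    Finset.measurable_sum _ fun j _ =>
      ((ha n j).comp measurable_fst).mul ((hbm n j).comp measurable_snd)
  have hκb : ∀ n x y, ‖κ n x y‖ ≤ M := fun n x y => by
    rw [hκeq]; split_ifs
    · exact hclip _ _
    · simpa using hM0
  refine isCompactOperator_of_tendsto (l := atTop)
    (tendsto_kernelOp (κ := κ) (M := M) hκm hκb (measurable_truncKernel hK t)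
      (norm_truncKernel_le hR hM t) ?_)
    (Eventually.of_forall fun n =>
      isCompactOperator_kernelOp_sum (S n) (ha n) (hbm n) (hA n) (hB n) (hκm n) (hκb n))
  refine ae_of_all _ fun p => ?_
  simp only [hκeq]
  unfold truncKernel
  split_ifs
  · have h1 : Tendsto (fun n : ℕ => (⌊((n : ℝ) + 1) * clip R p.1⌋ : ℝ) / ((n : ℝ) + 1)) atTop
        (𝓝 (clip R p.1)) := by
      rw [tendsto_iff_norm_sub_tendsto_zero]
      exact squeeze_zero (fun _ => norm_nonneg _) (fun n => abs_floor_div_sub_le n _)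
        tendsto_one_div_add_atTop_nhds_zero_nat
    have h2 := ((continuous_clip R).tendsto _).comp h1
    rw [clip_of_mem (abs_le.1 (abs_clip_le hR p.1))] at h2
    exact (Complex.continuous_ofReal.tendsto _).comp
      ((hK.tendsto _).comp (h2.add_const (clip R p.2)))
  · exact tendsto_const_nhds

theorem truncKernel_eq_zero_of_nonpos (h3 : CondK3 K) (hR : 0 < R) {t : ℝ} (ht : t ≤ 0) (x y : ℝ) :
    truncKernel K R t x y = 0 := by
  unfold truncKernel
  split_ifs with h
  · rw [h3, Complex.ofReal_zero]
    have aux : ∀ u, u < 0 → clip R u < 0 := fun u hu => by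
      unfold clip
      exact max_lt (by linarith) ((min_le_right _ _).trans_lt hu)
    linarith [aux x (h.1.trans_le ht), aux y (h.2.trans_le ht)]
  · rfl

theorem setIntegral_truncKernel {t x : ℝ} (hx : x ∈ Icc (-R) R) (hxt : x < t)
    (v : ℝ → ℂ) :
    ∫ y in Icc (-R) R, truncKernel K R t x y * v y =
      ∫ y in Iio t, (K (x + y) : ℂ) * (Icc (-R) R).indicator v y := by
  rw [← integral_indicator measurableSet_Icc, ← integral_indicator measurableSet_Iio]
  congr 1
  ext y
  by_cases hy : y ∈ Icc (-R) R <;> by_cases hyt : y < t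
  · simp [indicator_of_mem, hy, hyt, truncKernel, hxt, clip_of_mem hx, clip_of_mem hy]
  · simp [hy, hyt, truncKernel]
  · rw [indicator_of_notMem hy, indicator_apply]; simp [hy]
  · simp [hy, hyt]

/-- An eigenvector on `[-R, R]`, extended by zero, is an eigenvector of the operator of (K5) on
`(-∞, t)`. It stays nonzero there because the eigenvalue equation forces it to vanish between `t`
and `R`. -/
theorem not_eigenvector_truncKernel (hK : Continuous K) (h3 : CondK3 K) (h5 : CondK5 K ⊤)
    (hR : 0 ≤ R) (hM : ∀ u, |u| ≤ 2 * R → |K u| ≤ M) {t : ℝ} (ht0 : 0 ≤ t) (htR : t ≤ R) {σ : ℂ}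
    (hσ : σ = 1 ∨ σ = -1) (v : Lp ℂ 2 (volume.restrict (Icc (-R) R)))
    (hv : kernelOp (volume.restrict (Icc (-R) R)) (measurable_truncKernel (R := R) hK t)
      (norm_truncKernel_le hR hM t) v = σ • v) : v = 0 := by
  have hσ0 : σ ≠ 0 := by rcases hσ with h | h <;> simp [h]
  have hne : ¬ IsEigenvalueTruncOp K t σ := by
    have := h5.2 t ht0 (EReal.coe_lt_top t)
    rcases hσ with h | h
    · rw [h]; exact this.1
    · rw [h]; exact this.2
  have hae : ∀ᵐ x ∂(volume : Measure ℝ), x ∈ Icc (-R) R →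
      ∫ y in Icc (-R) R, truncKernel K R t x y * v y = σ * v x := by
    rw [← ae_restrict_iff' measurableSet_Icc]
    filter_upwards [kernelOp_coeFn (measurable_truncKernel (R := R) hK t)
      (norm_truncKernel_le hR hM t) v, Lp.coeFn_smul σ v] with x h1 h2
    rw [← h1, hv, h2, Pi.smul_apply, smul_eq_mul]
  by_contra hv0
  apply hne
  refine ⟨(Icc (-R) R).indicator v, ?_, ?_, ?_⟩
  · have : MemLp ((Icc (-R) R).indicator v) 2 (volume : Measure ℝ) :=
      (memLp_indicator_iff_restrict measurableSet_Icc).2 (Lp.memLp v)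
    exact this.restrict _
  · intro h0
    apply hv0
    refine Lp.ext (EventuallyEq.trans ?_ (Lp.coeFn_zero ℂ 2 _).symm)
    rw [EventuallyEq, ae_restrict_iff' measurableSet_Icc]
    rw [EventuallyEq, ae_restrict_iff' measurableSet_Iio] at h0
    filter_upwards [h0, hae] with x h1 h2 hx
    by_cases hxt : x < t
    · have := h1 hxt
      rwa [indicator_of_mem hx] at this
    · have := h2 hx
      simp only [truncKernel, hxt, false_and, if_false, zero_mul, integral_zero] at this
      simpa [hσ0] using this.symm
  · rw [EventuallyEq, ae_restrict_iff' measurableSet_Iio]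
    filter_upwards [hae] with x h2 hxt
    unfold truncOp
    rw [indicator_of_mem hxt]
    by_cases hx : x ∈ Icc (-R) R
    · rw [← setIntegral_truncKernel hx hxt, h2 hx, indicator_of_mem hx]
    · rw [indicator_of_notMem hx, mul_zero]
      refine setIntegral_eq_zero_of_forall_eq_zero fun y hy => ?_
      -- Here `x + y < -R + t ≤ 0`, so (K3) kills the integrand and extension by zero is consistent.
      have hxR : x < -R := by
        by_contra h
        exact hx ⟨not_lt.1 h, (mem_Iio.1 hxt).le.trans htR⟩
      rw [h3 (x + y) (by have := mem_Iio.1 hy; linarith)]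
      simp

/-- Continuity method: the norm starts at `0` for `t = 0`, and by the intermediate value theorem it
would have to pass through `1`, producing a forbidden eigenvalue. -/
theorem norm_kernelOp_truncKernel_lt_one (hK : Continuous K) (h3 : CondK3 K) (h5 : CondK5 K ⊤)
    (hR : 0 < R) (hM : ∀ u, |u| ≤ 2 * R → |K u| ≤ M) :
    ‖kernelOp (volume.restrict (Icc (-R) R)) (measurable_truncKernel (R := R) hK R)
      (norm_truncKernel_le hR.le hM R)‖ < 1 := by
  set T : ℝ → Lp ℂ 2 (volume.restrict (Icc (-R) R)) →L[ℂ] Lp ℂ 2 (volume.restrict (Icc (-R) R)) :=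
    fun t => kernelOp (volume.restrict (Icc (-R) R)) (measurable_truncKernel (R := R) hK t)
      (norm_truncKernel_le hR.le hM t) with hT
  have hcont : Continuous fun t => ‖T t‖ := by
    refine continuous_norm.comp (continuous_iff_continuousAt.2 fun t => ?_)
    exact tendsto_kernelOp (M := M) (fun s => measurable_truncKernel hK s)
      (fun s => norm_truncKernel_le hR.le hM s) (measurable_truncKernel hK t)
      (norm_truncKernel_le hR.le hM t) (tendsto_truncKernel t)
  have hT0 : ‖T 0‖ = 0 := by
    refine le_antisymm ((norm_kernelOp_le _ _).trans ?_) (norm_nonneg _)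
    simp [truncKernel_eq_zero_of_nonpos h3 hR le_rfl]
  by_contra! hge
  obtain ⟨t, ht, h1⟩ := intermediate_value_Icc hR.le hcont.continuousOn
    (show (1 : ℝ) ∈ Icc ‖T 0‖ ‖T R‖ from ⟨by rw [hT0]; norm_num, hge⟩)
  obtain ⟨σ, hσ, v, hv0, hv⟩ := exists_eigenvalue_of_norm_eq_one
    (isCompactOperator_truncKernel hK hR.le hM t)
    (isSymmetric_kernelOp _ _ (fun x y => conj_truncKernel t x y)) h1
  exact hv0 (not_eigenvector_truncKernel hK h3 h5 hR.le hM ht.1 ht.2 hσ v hv)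

theorem setIntegral_truncKernel_self (f : ℝ → ℂ) {x : ℝ} (hx : x ∈ Icc (-R) R) (hxR : x < R) :
    ∫ y in Icc (-R) R, truncKernel K R R x y * f y = ∫ y in Icc (-R) R, (K (x + y) : ℂ) * f y := by
  refine integral_congr_ae ?_
  filter_upwards [ae_restrict_mem measurableSet_Icc, ae_ne_restrict (Icc (-R) R) R] with y hy hyR
  simp [truncKernel, hxR, lt_of_le_of_ne hy.2 hyR, clip_of_mem hx, clip_of_mem hy]

/-- The contraction property in terms of plain integrals. The cutoff at `t = R` removes only the
endpoint of the interval. -/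
theorem integral_norm_sq_hankel_le (hK : Continuous K) (h3 : CondK3 K) (h5 : CondK5 K ⊤)
    (hR : 0 < R) {f : ℝ → ℂ} (hf : MemLp f 2 (volume.restrict (Icc (-R) R))) :
    ∫ x in Icc (-R) R, ‖∫ y in Icc (-R) R, (K (x + y) : ℂ) * f y‖ ^ 2 ≤
      ∫ x in Icc (-R) R, ‖f x‖ ^ 2 := by
  obtain ⟨M, hM⟩ := exists_bound_on_interval hK (2 * R)
  set T := kernelOp (volume.restrict (Icc (-R) R)) (measurable_truncKernel (R := R) hK R)
      (norm_truncKernel_le hR.le hM R) with hT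
  have h1 : ‖T hf.toLp‖ ^ 2 ≤ ‖hf.toLp‖ ^ 2 := by
    gcongr
    refine (T.le_opNorm _).trans (mul_le_of_le_one_left (norm_nonneg _) ?_)
    exact (norm_kernelOp_truncKernel_lt_one hK h3 h5 hR hM).le
  rw [Lp_norm_sq_eq, Lp_norm_sq_eq] at h1
  refine (integral_congr_ae ?_).trans_le (h1.trans_eq (integral_congr_ae ?_))
  · filter_upwards [kernelOp_coeFn (measurable_truncKernel (R := R) hK R)
      (norm_truncKernel_le hR.le hM R) hf.toLp, ae_restrict_mem measurableSet_Icc,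
      ae_ne_restrict (Icc (-R) R) R] with x h2 hx hxR
    rw [h2, setIntegral_truncKernel_self _ hx (lt_of_le_of_ne hx.2 hxR)]
    congr 2
    refine integral_congr_ae ?_
    filter_upwards [hf.coeFn_toLp] with y hy
    rw [hy]
  · filter_upwards [hf.coeFn_toLp] with y hy
    rw [hy]

/-- Norm below one makes `1 - σ T` invertible on `L²`. -/
theorem exists_solution_hankel (hK : Continuous K) (h3 : CondK3 K) (h5 : CondK5 K ⊤)
    (hR : 0 < R) {σ : ℂ} (hσ : ‖σ‖ = 1) {g : ℝ → ℂ} (hg : Continuous g) :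
    ∃ u : ℝ → ℂ, Continuous u ∧
      ∀ x, u x = g x + σ * ∫ y in Icc (-R) R, (K (x + y) : ℂ) * u y := by
  obtain ⟨M, hM⟩ := exists_bound_on_interval hK (2 * R)
  set T := kernelOp (volume.restrict (Icc (-R) R)) (measurable_truncKernel (R := R) hK R)
      (norm_truncKernel_le hR.le hM R) with hT
  have hgL : MemLp g 2 (volume.restrict (Icc (-R) R)) := by
    obtain ⟨B, hB⟩ := (isCompact_Icc (a := -R) (b := R)).exists_bound_of_continuousOn
      hg.continuousOn
    exact MemLp.of_bound hg.aestronglyMeasurable B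
      ((ae_restrict_iff' measurableSet_Icc).2 (ae_of_all _ hB))
  have hunit : IsUnit (1 - σ • T) := by
    refine isUnit_one_sub_of_norm_lt_one ?_
    rw [norm_smul, hσ, one_mul]
    exact norm_kernelOp_truncKernel_lt_one hK h3 h5 hR hM
  obtain ⟨w, hw⟩ := hunit
  set v := ((w⁻¹).val) hgL.toLp with hvdef
  have hv : v - σ • T v = hgL.toLp := by
    have : (1 - σ • T) v = hgL.toLp := by
      rw [← hw, hvdef, ← mul_apply_eq_comp, Units.mul_inv]; simp
    simpa using this
  have hvI : IntegrableOn v (Icc (-R) R) := (Lp.memLp v).integrable (by norm_num)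
  have hvae : ∀ᵐ x ∂(volume.restrict (Icc (-R) R)),
      v x = g x + σ * ∫ y in Icc (-R) R, (K (x + y) : ℂ) * v y := by
    have hv' : v = hgL.toLp + σ • T v := by rw [← hv]; abel
    have e : (v : ℝ → ℂ) =ᵐ[volume.restrict (Icc (-R) R)] ⇑(hgL.toLp + σ • T v) := by
      rw [← hv']
    filter_upwards [e, Lp.coeFn_add hgL.toLp (σ • T v), Lp.coeFn_smul σ (T v), hgL.coeFn_toLp,
      kernelOp_coeFn (measurable_truncKernel (R := R) hK R) (norm_truncKernel_le hR.le hM R) v,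
      ae_restrict_mem measurableSet_Icc, ae_ne_restrict (Icc (-R) R) R]
      with x a1 a2 a3 a4 a5 hx hxR
    rw [a1, a2, Pi.add_apply, a4, a3, Pi.smul_apply, a5, smul_eq_mul,
      setIntegral_truncKernel_self _ hx (lt_of_le_of_ne hx.2 hxR)]
  -- The right-hand side of the equation is a continuous representative of the `L²` solution, and it
  -- solves the equation at every point.
  refine ⟨fun x => g x + σ * ∫ y in Icc (-R) R, (K (x + y) : ℂ) * v y,
    hg.add (continuous_const.mul (continuous_integral_translate hK hvI)), fun x => ?_⟩
  simp only
  congr 2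
  refine integral_congr_ae ?_
  filter_upwards [hvae] with y hy
  rw [← hy]

end Trunc

/-! ### Fourier integrals in half-planes -/

theorem norm_exp_I_mul (z : ℂ) (x : ℝ) :
    ‖Complex.exp (Complex.I * z * x)‖ = Real.exp (-(z.im * x)) := by
  rw [Complex.norm_exp]
  congr 1
  simp

theorem continuous_exp_I_mul (z : ℂ) : Continuous fun x : ℝ => Complex.exp (Complex.I * z * x) := by
  fun_prop

theorem isOpen_im_gt (a : ℝ) : IsOpen {z : ℂ | a < z.im} :=
  isOpen_lt continuous_const Complex.continuous_im

theorem differentiableOn_transform {ν : Measure ℝ} {f : ℝ → ℂ} {a : ℝ}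
    (hf : AEStronglyMeasurable f ν)
    (hI : ∀ z : ℂ, a < z.im → Integrable (fun x : ℝ => f x * Complex.exp (Complex.I * z * x)) ν) :
    DifferentiableOn ℂ (fun z => ∫ x, f x * Complex.exp (Complex.I * z * x) ∂ν)
      {z : ℂ | a < z.im} := by
  intro z₀ hz₀
  rw [mem_ofPred_eq] at hz₀
  -- A quarter of the distance to the boundary leaves room for `z₀ ± 2iε`. The derivative's factor
  -- `|x|` costs one `e^{ε|x|}` and moving `z` off `z₀` costs another; together they are dominated
  -- by the sum of the integrands at these two points.
  set ε := (z₀.im - a) / 4 with hε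
  have hε0 : 0 < ε := by rw [hε]; linarith
  have h1 := (hI (z₀ + Complex.I * (2 * ε : ℝ)) (by simp; linarith)).norm
  have h2 := (hI (z₀ - Complex.I * (2 * ε : ℝ)) (by simp; linarith)).norm
  have key := hasDerivAt_integral_of_dominated_loc_of_deriv_le (𝕜 := ℂ) (μ := ν) (x₀ := z₀)
    (F := fun z x => f x * Complex.exp (Complex.I * z * x))
    (F' := fun z x => f x * (Complex.I * x * Complex.exp (Complex.I * z * x)))
    (bound := fun x => ε⁻¹ * (‖f x * Complex.exp (Complex.I * (z₀ + Complex.I * (2 * ε : ℝ)) * x)‖ +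
      ‖f x * Complex.exp (Complex.I * (z₀ - Complex.I * (2 * ε : ℝ)) * x)‖))
    (Metric.ball_mem_nhds z₀ hε0)
    (Eventually.of_forall fun z => hf.mul (continuous_exp_I_mul z).aestronglyMeasurable)
    (hI z₀ hz₀) (hf.mul (Continuous.aestronglyMeasurable (by fun_prop))) ?_
    ((h1.add h2).const_mul _) ?_
  · exact key.2.differentiableAt.differentiableWithinAt
  · refine ae_of_all _ fun x z hz => ?_
    simp only [norm_mul, norm_exp_I_mul, Complex.norm_I, one_mul, Complex.norm_real,
      Real.norm_eq_abs]
    rw [← mul_add, mul_left_comm ε⁻¹]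
    refine mul_le_mul_of_nonneg_left ?_ (norm_nonneg (f x))
    rw [← div_eq_inv_mul, le_div_iff₀ hε0]
    have hzim : |z.im - z₀.im| ≤ ε := by
      rw [Metric.mem_ball, dist_eq_norm] at hz
      rw [← Complex.sub_im]
      exact (Complex.abs_im_le_norm _).trans hz.le
    have e1 : |x| * ε ≤ Real.exp (|x| * ε) := by linarith [Real.add_one_le_exp (|x| * ε)]
    have e2 : Real.exp (-(z.im * x)) ≤ Real.exp (-(z₀.im * x) + |x| * ε) := by
      apply Real.exp_le_exp.2
      have : -((z.im - z₀.im) * x) ≤ |x| * ε := by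
        refine (neg_le_abs _).trans ?_
        rw [abs_mul, mul_comm]; gcongr
      linarith
    calc |x| * Real.exp (-(z.im * x)) * ε = (|x| * ε) * Real.exp (-(z.im * x)) := by ring
      _ ≤ Real.exp (|x| * ε) * Real.exp (-(z₀.im * x) + |x| * ε) := by gcongr
      _ = Real.exp (-(z₀.im * x) + 2 * ε * |x|) := by rw [← Real.exp_add]; congr 1; ring
      _ ≤ _ := by
        rcases abs_choice x with h | h <;> rw [h]
        · refine le_add_of_nonneg_of_le (by positivity) (Real.exp_le_exp.2 ?_)
          simp; linarith
        · refine le_add_of_le_of_nonneg (Real.exp_le_exp.2 ?_) (by positivity)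
          simp; linarith
  · refine ae_of_all _ fun x z _ => ?_
    have h := (((hasDerivAt_id z).const_mul Complex.I).mul_const (x : ℂ)).cexp.const_mul (f x)
    exact h.congr_deriv (by simp only [id]; ring)

theorem differentiable_transform {ν : Measure ℝ} {f : ℝ → ℂ} (hf : AEStronglyMeasurable f ν)
    (hI : ∀ z : ℂ, Integrable (fun x : ℝ => f x * Complex.exp (Complex.I * z * x)) ν) :
    Differentiable ℂ fun z => ∫ x, f x * Complex.exp (Complex.I * z * x) ∂ν := fun z =>
  (differentiableOn_transform (a := z.im - 1) hf fun z _ => hI z).differentiableAt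
    ((isOpen_im_gt _).mem_nhds (by simp))

theorem exists_exp_bound {K : ℝ → ℝ} {c : ℝ} (hc : 0 ≤ c) (hK : Continuous K)
    (hg : K =O[cocompact ℝ] fun x : ℝ => Real.exp (c * |x|)) :
    ∃ M : ℝ, 0 ≤ M ∧ ∀ x, |K x| ≤ M * Real.exp (c * |x|) := by
  obtain ⟨C, hC⟩ := hg.bound
  obtain ⟨S, hS, hSC⟩ := mem_cocompact.1 hC
  obtain ⟨B, hB⟩ := hS.exists_bound_of_continuousOn hK.continuousOn
  refine ⟨max 0 (max B C), le_max_left _ _, fun x => ?_⟩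
  by_cases hx : x ∈ S
  · have h1 : 1 ≤ Real.exp (c * |x|) := Real.one_le_exp (by positivity)
    calc |K x| ≤ B := hB x hx
      _ ≤ max 0 (max B C) := (le_max_left _ _).trans (le_max_right _ _)
      _ ≤ _ := le_mul_of_one_le_right (le_max_left _ _) h1
  · have := hSC hx
    simp only [mem_ofPred_eq, Real.norm_eq_abs, Real.abs_exp] at this
    refine this.trans ?_
    gcongr
    exact (le_max_right _ _).trans (le_max_right _ _)

/-- A function vanishing to the left of `a` and growing at most like `e^{cx}` has a Fourier integral
in `Im z > c`. -/
theorem integrable_mul_exp {f : ℝ → ℂ} {a c M : ℝ} (hf : AEStronglyMeasurable f volume)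
    (h0 : ∀ x < a, f x = 0) (hb : ∀ x, a ≤ x → ‖f x‖ ≤ M * Real.exp (c * x)) {z : ℂ}
    (hz : c < z.im) :
    Integrable fun x : ℝ => f x * Complex.exp (Complex.I * z * x) := by
  have h1 : IntegrableOn (fun x : ℝ => f x * Complex.exp (Complex.I * z * x)) (Ioi a) := by
    refine Integrable.mono' ((integrableOn_exp_mul_Ioi (a := c - z.im) (by linarith) a).const_mul M)
      (hf.mul (continuous_exp_I_mul z).aestronglyMeasurable).restrict
      ((ae_restrict_iff' measurableSet_Ioi).2 (ae_of_all _ fun x hx => ?_))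
    rw [norm_mul, norm_exp_I_mul]
    calc _ ≤ (M * Real.exp (c * x)) * Real.exp (-(z.im * x)) := by
          gcongr; exact hb x (mem_Ioi.1 hx).le
      _ = _ := by rw [mul_assoc, ← Real.exp_add]; congr 2; ring
  rw [← integrableOn_Ici_iff_integrableOn_Ioi] at h1
  refine (integrableOn_iff_integrable_of_support_subset ?_).1 h1
  intro x hx
  by_contra h
  exact hx (by simp [h0 x (not_le.1 h)])

theorem exists_exp_bound_of_condK3 {K : ℝ → ℝ} {c : ℝ} (hc : 0 ≤ c) (hK : Continuous K)
    (hg : K =O[cocompact ℝ] fun x : ℝ => Real.exp (c * |x|)) (h3 : CondK3 K) :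
    ∃ M : ℝ, 0 ≤ M ∧ ∀ x, |K x| ≤ M * Real.exp (c * x) := by
  obtain ⟨M, hM0, hM⟩ := exists_exp_bound hc hK hg
  refine ⟨M, hM0, fun x => ?_⟩
  rcases lt_or_ge x 0 with hx | hx
  · rw [h3 x hx]; simp; positivity
  · simpa [abs_of_nonneg hx] using hM x

theorem integrable_kernel_exp {K : ℝ → ℝ} {c M : ℝ} (hK : Continuous K) (h3 : CondK3 K)
    (hM : ∀ x, |K x| ≤ M * Real.exp (c * x)) {z : ℂ} (hz : c < z.im) :
    Integrable fun x : ℝ => (K x : ℂ) * Complex.exp (Complex.I * z * x) :=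
  integrable_mul_exp (a := 0) (Complex.continuous_ofReal.comp hK).aestronglyMeasurable
    (fun x hx => by simp [h3 x hx]) (fun x _ => by simpa using hM x) hz

theorem fourierIntegral_eq (K : ℝ → ℝ) (z : ℂ) :
    fourierIntegral K z = ∫ x : ℝ, (K x : ℂ) * Complex.exp (Complex.I * z * x) := by
  unfold fourierIntegral
  congr 1; ext x; congr 2; ring

theorem integrable_hankel_prod {K : ℝ → ℝ} (hK : Continuous K) {ν : Measure ℝ} [SFinite ν]
    {f : ℝ → ℂ} {z : ℂ}
    (hKI : Integrable fun x : ℝ => (K x : ℂ) * Complex.exp (Complex.I * z * x))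
    (hf : Integrable (fun y : ℝ => f y * Complex.exp (Complex.I * -z * y)) ν) :
    Integrable (fun p : ℝ × ℝ => (K (p.1 + p.2) : ℂ) * Complex.exp (Complex.I * z * (p.1 + p.2 : ℝ))
      * (f p.2 * Complex.exp (Complex.I * -z * p.2))) (volume.prod ν) := by
  have hm : AEStronglyMeasurable (fun p : ℝ × ℝ => (K (p.1 + p.2) : ℂ) *
      Complex.exp (Complex.I * z * (p.1 + p.2 : ℝ)) * (f p.2 * Complex.exp (Complex.I * -z * p.2)))
      (volume.prod ν) := by
    refine AEStronglyMeasurable.mul (Continuous.aestronglyMeasurable ?_) hf.1.comp_snd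
    exact (Complex.continuous_ofReal.comp (hK.comp (by fun_prop))).mul (by fun_prop)
  rw [integrable_prod_iff' hm]
  constructor
  · exact ae_of_all _ fun y => (hKI.comp_add_right y).mul_const (f y * Complex.exp (Complex.I * -z * y))
  · have : ∀ y : ℝ, ∫ x : ℝ, ‖(K (x + y) : ℂ) * Complex.exp (Complex.I * z * (x + y : ℝ)) *
        (f y * Complex.exp (Complex.I * -z * y))‖ =
        (∫ x : ℝ, ‖(K x : ℂ) * Complex.exp (Complex.I * z * x)‖) *
          ‖f y * Complex.exp (Complex.I * -z * y)‖ := by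
      intro y
      simp_rw [norm_mul _ (f y * _)]
      rw [integral_mul_const, integral_add_right_eq_self
        (fun x : ℝ => ‖(K x : ℂ) * Complex.exp (Complex.I * z * x)‖) y]
    simp only [this]
    exact hf.norm.const_mul _

theorem hankel_mul_exp_eq {K : ℝ → ℝ} {ν : Measure ℝ} (f : ℝ → ℂ) (z : ℂ) (x : ℝ) :
    (∫ y, (K (x + y) : ℂ) * f y ∂ν) * Complex.exp (Complex.I * z * x) =
      ∫ y, (K (x + y) : ℂ) * Complex.exp (Complex.I * z * (x + y : ℝ))
        * (f y * Complex.exp (Complex.I * -z * y)) ∂ν := by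
  rw [← integral_mul_const]
  congr 1; ext y
  have : Complex.exp (Complex.I * z * x) = Complex.exp (Complex.I * z * (x + y : ℝ)) *
      Complex.exp (Complex.I * -z * y) := by
    rw [← Complex.exp_add]; congr 1; push_cast; ring
  rw [this]; ring

theorem integrable_hankel_mul_exp {K : ℝ → ℝ} (hK : Continuous K) {ν : Measure ℝ} [SFinite ν]
    {f : ℝ → ℂ} {z : ℂ}
    (hKI : Integrable fun x : ℝ => (K x : ℂ) * Complex.exp (Complex.I * z * x))
    (hf : Integrable (fun y : ℝ => f y * Complex.exp (Complex.I * -z * y)) ν) :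
    Integrable fun x : ℝ => (∫ y, (K (x + y) : ℂ) * f y ∂ν) * Complex.exp (Complex.I * z * x) := by
  simp only [hankel_mul_exp_eq]
  exact (integrable_hankel_prod hK hKI hf).integral_prod_left

/-- Writing `e^{izx} = e^{iz(x+y)} e^{-izy}` and substituting `x + y` for the variable decouples the
two integrals: the Hankel operator is multiplication by the Fourier integral of `K`, followed by the
reflection `z ↦ -z` in the input. -/
theorem integral_hankel_mul_exp {K : ℝ → ℝ} (hK : Continuous K) {ν : Measure ℝ} [SFinite ν]
    {f : ℝ → ℂ} {z : ℂ}
    (hKI : Integrable fun x : ℝ => (K x : ℂ) * Complex.exp (Complex.I * z * x))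
    (hf : Integrable (fun y : ℝ => f y * Complex.exp (Complex.I * -z * y)) ν) :
    ∫ x : ℝ, (∫ y, (K (x + y) : ℂ) * f y ∂ν) * Complex.exp (Complex.I * z * x) =
      fourierIntegral K z * ∫ y, f y * Complex.exp (Complex.I * -z * y) ∂ν := by
  simp only [hankel_mul_exp_eq]
  rw [integral_integral_swap (f := fun x y : ℝ => (K (x + y) : ℂ) *
    Complex.exp (Complex.I * z * (x + y : ℝ)) * (f y * Complex.exp (Complex.I * -z * y)))
    (integrable_hankel_prod hK hKI hf), ← integral_const_mul]
  congr 1; ext y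
  rw [integral_mul_const, integral_add_right_eq_self
    (fun x : ℝ => (K x : ℂ) * Complex.exp (Complex.I * z * x)) y, fourierIntegral_eq]

/-! ### Extension of the Fourier integral to a Schur function -/

section Schur

variable {K : ℝ → ℝ} {c M : ℝ}

/-- The response `x ↦ ∫_{-N}^0 K(x+y) f(y) dy`. -/
def response (K : ℝ → ℝ) (N : ℝ) (f : ℝ → ℂ) (x : ℝ) : ℂ :=
  ∫ y in Icc (-N) 0, (K (x + y) : ℂ) * f y

theorem continuous_response (hK : Continuous K) (N : ℝ) {f : ℝ → ℂ} (hf : Continuous f) :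
    Continuous (response K N f) :=
  continuous_integral_translate hK hf.integrableOn_Icc

theorem response_of_neg (h3 : CondK3 K) (N : ℝ) (f : ℝ → ℂ) {x : ℝ} (hx : x < 0) :
    response K N f x = 0 :=
  setIntegral_eq_zero_of_forall_eq_zero fun y hy => by
    rw [h3 _ (by linarith [hy.2])]; simp

theorem integral_Icc_norm_sq_response_le (hK : Continuous K) (h3 : CondK3 K) (h5 : CondK5 K ⊤)
    {N R : ℝ} (hR : 0 < R) (hNR : N ≤ R) {f : ℝ → ℂ} (hf : Continuous f) :
    ∫ x in Icc (-R) R, ‖response K N f x‖ ^ 2 ≤ ∫ y in Icc (-N) 0, ‖f y‖ ^ 2 := by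
  have hsub : Icc (-N) 0 ⊆ Icc (-R) R := Icc_subset_Icc (by linarith) hR.le
  have hL : MemLp ((Icc (-N) 0).indicator f) 2 (volume.restrict (Icc (-R) R)) := by
    obtain ⟨B, hB⟩ := (isCompact_Icc (a := -N) (b := 0)).exists_bound_of_continuousOn
      hf.continuousOn
    refine MemLp.of_bound (hf.aestronglyMeasurable.indicator measurableSet_Icc) (max B 0)
      (ae_of_all _ fun x => ?_)
    by_cases hx : x ∈ Icc (-N) 0
    · rw [indicator_of_mem hx]; exact (hB x hx).trans (le_max_left _ _)
    · rw [indicator_of_notMem hx, norm_zero]; exact le_max_right _ _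
  have h := integral_norm_sq_hankel_le hK h3 h5 hR hL
  have e1 : ∀ x : ℝ, ∫ y in Icc (-R) R, (K (x + y) : ℂ) * (Icc (-N) 0).indicator f y =
      response K N f x := by
    intro x
    have : ∀ y : ℝ, (K (x + y) : ℂ) * (Icc (-N) 0).indicator f y =
        (Icc (-N) 0).indicator (fun y => (K (x + y) : ℂ) * f y) y := fun y => by
      by_cases hy : y ∈ Icc (-N) 0
      · rw [indicator_of_mem hy, indicator_of_mem hy]
      · rw [indicator_of_notMem hy, indicator_of_notMem hy, mul_zero]
    simp_rw [this]
    rw [setIntegral_indicator measurableSet_Icc, inter_eq_self_of_subset_right hsub]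
    rfl
  have e2 : ∫ x in Icc (-R) R, ‖(Icc (-N) 0).indicator f x‖ ^ 2 =
      ∫ y in Icc (-N) 0, ‖f y‖ ^ 2 := by
    have : ∀ y : ℝ, ‖(Icc (-N) 0).indicator f y‖ ^ 2 =
        (Icc (-N) 0).indicator (fun y => ‖f y‖ ^ 2) y := fun y => by
      by_cases hy : y ∈ Icc (-N) 0
      · rw [indicator_of_mem hy, indicator_of_mem hy]
      · rw [indicator_of_notMem hy, indicator_of_notMem hy]; simp
    simp_rw [this]
    rw [setIntegral_indicator measurableSet_Icc, inter_eq_self_of_subset_right hsub]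
  simp_rw [e1] at h
  exact h.trans_eq e2

/-- The contraction estimate on `[-R, R]` does not depend on `R`, so `R → ∞` gives it on the whole
line. -/
theorem norm_sq_response (hK : Continuous K) (h3 : CondK3 K) (h5 : CondK5 K ⊤) (N : ℝ)
    {f : ℝ → ℂ} (hf : Continuous f) :
    Integrable (fun x => ‖response K N f x‖ ^ 2) ∧
      ∫ x, ‖response K N f x‖ ^ 2 ≤ ∫ y in Icc (-N) 0, ‖f y‖ ^ 2 := by
  have hcont : Continuous fun x => ‖response K N f x‖ ^ 2 :=
    (continuous_response hK N hf).norm.pow 2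
  have hbound : ∀ᶠ R : ℝ in atTop, ∫ x in (-R)..R, ‖response K N f x‖ ^ 2 ≤
      ∫ y in Icc (-N) 0, ‖f y‖ ^ 2 := by
    filter_upwards [eventually_gt_atTop 0, eventually_ge_atTop N] with R hR hNR
    rw [intervalIntegral.integral_of_le (by linarith), ← integral_Icc_eq_integral_Ioc]
    exact integral_Icc_norm_sq_response_le hK h3 h5 hR hNR hf
  have hI : Integrable (fun x => ‖response K N f x‖ ^ 2) := by
    refine integrable_of_intervalIntegral_norm_bounded (l := atTop) (a := fun R : ℝ => -R)
      (b := fun R => R) (∫ y in Icc (-N) 0, ‖f y‖ ^ 2)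
      (fun R => hcont.integrableOn_Ioc) tendsto_neg_atTop_atBot tendsto_id ?_
    simpa using hbound
  exact ⟨hI, le_of_tendsto
    (intervalIntegral_tendsto_integral hI tendsto_neg_atTop_atBot tendsto_id) hbound⟩

theorem memLp_exp_Ici {z : ℂ} (hz : 0 < z.im) :
    MemLp (fun x : ℝ => Complex.exp (Complex.I * z * x)) 2 (volume.restrict (Ici 0)) ∧
      ∫ x in Ici (0 : ℝ), ‖Complex.exp (Complex.I * z * x)‖ ^ 2 = 1 / (2 * z.im) := by
  have e : ∀ x : ℝ, ‖Complex.exp (Complex.I * z * x)‖ ^ 2 = Real.exp (-(2 * z.im) * x) := by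
    intro x
    rw [norm_exp_I_mul, sq, ← Real.exp_add]; congr 1; ring
  rw [memLp_two_iff_integrable_sq_norm (continuous_exp_I_mul z).aestronglyMeasurable]
  simp_rw [e]
  rw [integral_Ici_eq_integral_Ioi, integral_exp_mul_Ioi (by linarith)]
  refine ⟨(integrableOn_Ici_iff_integrableOn_Ioi (by simp)).2 (integrableOn_exp_mul_Ioi (by linarith) 0), ?_⟩
  simp

/-- The response is an `L²` function on `[0, ∞)`, so its transform exists in the whole upper
half-plane and Cauchy–Schwarz against the exponential bounds it. -/
theorem response_transform (hK : Continuous K) (h3 : CondK3 K) (h5 : CondK5 K ⊤) (N : ℝ)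
    {f : ℝ → ℂ} (hf : Continuous f) {z : ℂ} (hz : 0 < z.im) :
    Integrable (fun x : ℝ => response K N f x * Complex.exp (Complex.I * z * x)) ∧
      ‖∫ x : ℝ, response K N f x * Complex.exp (Complex.I * z * x)‖ ^ 2 ≤
        (∫ y in Icc (-N) 0, ‖f y‖ ^ 2) * (1 / (2 * z.im)) := by
  obtain ⟨h1, h2⟩ := norm_sq_response hK h3 h5 N hf
  obtain ⟨h4, h6⟩ := memLp_exp_Ici hz
  have hL : MemLp (response K N f) 2 volume :=
    (memLp_two_iff_integrable_sq_norm (continuous_response hK N hf).aestronglyMeasurable).2 h1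
  have hs : ∀ x : ℝ, x ∉ Ici (0 : ℝ) →
      response K N f x * Complex.exp (Complex.I * z * x) = 0 := fun x hx => by
    rw [response_of_neg h3 N f (not_le.1 hx), zero_mul]
  constructor
  · refine (integrableOn_iff_integrable_of_support_subset ?_).1
      ((hL.restrict (Ici 0)).integrable_mul h4)
    intro x hx
    by_contra h
    exact hx (hs x h)
  · rw [← setIntegral_eq_integral_of_forall_compl_eq_zero hs]
    refine (norm_sq_integral_mul_le (hL.restrict _) h4).trans ?_
    rw [h6]
    refine mul_le_mul_of_nonneg_right ?_ (by positivity)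
    exact (setIntegral_le_integral h1 (ae_of_all _ fun x => by positivity)).trans h2

theorem isPreconnected_im_gt (a : ℝ) : IsPreconnected {z : ℂ | a < z.im} :=
  (convex_halfSpace_im_gt a).isPreconnected

theorem integrable_continuous_exp (N : ℝ) {f : ℝ → ℂ} (hf : Continuous f) (z : ℂ) :
    Integrable (fun y : ℝ => f y * Complex.exp (Complex.I * z * y))
      (volume.restrict (Icc (-N) 0)) :=
  (hf.mul (continuous_exp_I_mul z)).integrableOn_Icc

theorem differentiable_transform_neg (N : ℝ) {f : ℝ → ℂ} (hf : Continuous f) :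
    Differentiable ℂ fun z => ∫ y in Icc (-N) 0, f y * Complex.exp (Complex.I * -z * y) :=
  (differentiable_transform hf.aestronglyMeasurable (integrable_continuous_exp N hf)).comp
    differentiable_neg

/-- A zero would force `e^{iz} = 1`, but this exponential has modulus below `1`. The integral is the
denominator in the construction of `Θ`. -/
theorem integral_exp_ne_zero {z : ℂ} (hz : 0 < z.im) :
    ∫ y in Icc (-1 : ℝ) 0, (1 : ℂ) * Complex.exp (Complex.I * -z * y) ≠ 0 := by
  have hz0 : Complex.I * -z ≠ 0 := by
    intro h
    have : z = 0 := by simpa using h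
    simp [this] at hz
  simp_rw [one_mul]
  rw [integral_Icc_eq_integral_Ioc, ← intervalIntegral.integral_of_le (by norm_num),
    integral_exp_mul_complex hz0]
  refine div_ne_zero ?_ hz0
  intro h
  have h1 : ‖Complex.exp (Complex.I * z * (1 : ℝ))‖ = 1 := by
    have : Complex.exp (Complex.I * -z * ((-1 : ℝ) : ℂ)) = 1 := by
      rw [sub_eq_zero] at h; rw [← h]; simp
    rw [show Complex.I * z * ((1 : ℝ) : ℂ) = Complex.I * -z * ((-1 : ℝ) : ℂ) by push_cast; ring,
      this, norm_one]
  rw [norm_exp_I_mul, Real.exp_eq_one_iff] at h1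
  linarith

/-- The Fourier integral of `K` extends from `Im z > c` to a Schur function in the upper
half-plane. -/
theorem exists_schur_extension (hc : 0 < c) (hK : Continuous K) (h3 : CondK3 K)
    (h5 : CondK5 K ⊤) (hM : ∀ x, |K x| ≤ M * Real.exp (c * x)) :
    ∃ Θ : ℂ → ℂ, DifferentiableOn ℂ Θ {z : ℂ | 0 < z.im} ∧ (∀ z : ℂ, 0 < z.im → ‖Θ z‖ ≤ 1) ∧
      ∀ z : ℂ, c < z.im → Θ z = fourierIntegral K z := by
  let tr : ℝ → (ℝ → ℂ) → ℂ → ℂ := fun N f z =>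
    ∫ x : ℝ, response K N f x * Complex.exp (Complex.I * z * x)
  let inp : ℝ → (ℝ → ℂ) → ℂ → ℂ := fun N f z =>
    ∫ y in Icc (-N) 0, f y * Complex.exp (Complex.I * -z * y)
  have htr : ∀ N f, Continuous f → DifferentiableOn ℂ (tr N f) {z : ℂ | 0 < z.im} :=
    fun N f hf => differentiableOn_transform (continuous_response hK N hf).aestronglyMeasurable
      fun z hz => (response_transform hK h3 h5 N hf hz).1
  have heq : ∀ N f, Continuous f → ∀ z : ℂ, c < z.im →
      tr N f z = fourierIntegral K z * inp N f z := fun N f hf z hz =>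
    integral_hankel_mul_exp hK (integrable_kernel_exp hK h3 hM hz)
      (integrable_continuous_exp N hf (-z))
  -- `Θ` is the output transform over the input transform for the test input `1` on `[-1, 0]`.
  have hΘd : DifferentiableOn ℂ (fun z => tr 1 (fun _ => 1) z / inp 1 (fun _ => 1) z)
      {z : ℂ | 0 < z.im} :=
    (htr 1 _ continuous_const).div (differentiable_transform_neg 1 continuous_const).differentiableOn
      fun z hz => integral_exp_ne_zero hz
  have hΘeq : ∀ z : ℂ, c < z.im →
      tr 1 (fun _ => 1) z / inp 1 (fun _ => 1) z = fourierIntegral K z := fun z hz => by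
    rw [heq 1 _ continuous_const z hz,
      mul_div_cancel_right₀ _ (integral_exp_ne_zero (hc.trans hz))]
  refine ⟨_, hΘd, fun z hz => ?_, hΘeq⟩
  set Θ := fun z => tr 1 (fun _ => 1) z / inp 1 (fun _ => 1) z with hΘ
  -- By the identity theorem the same `Θ` serves every input, so the bound at a given `z` may be
  -- tested with an input adapted to `z`.
  have hall : ∀ N f, Continuous f → EqOn (tr N f) (fun z => Θ z * inp N f z) {z : ℂ | 0 < z.im} := by
    intro N f hf
    have ho := isOpen_im_gt 0
    refine AnalyticOnNhd.eqOn_of_preconnected_of_eventuallyEq ((htr N f hf).analyticOnNhd ho)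
      ((hΘd.mul (differentiable_transform_neg N hf).differentiableOn).analyticOnNhd ho)
      (isPreconnected_im_gt 0) (z₀ := Complex.I * ((c + 1 : ℝ) : ℂ)) ?_ ?_
    · simp; linarith
    · filter_upwards [(isOpen_im_gt c).mem_nhds
        (show Complex.I * ((c + 1 : ℝ) : ℂ) ∈ {z : ℂ | c < z.im} by simp)] with w hw
      rw [heq N f hf w hw, hΘ]
      simp only
      rw [hΘeq w hw]
  have hbound : ∀ N : ℝ, 0 < N → ‖Θ z‖ ^ 2 * (1 - Real.exp (-(2 * z.im) * N)) ≤ 1 := by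
    intro N hN
    -- The extremal input for evaluation at `z`: its transform at `z` equals its squared norm `J`.
    -- The estimate becomes `‖Θ z‖² J ≤ 1/(2 Im z)`, and `J → 1/(2 Im z)` as `N → ∞`.
    set f : ℝ → ℂ := fun y => conj (Complex.exp (Complex.I * -z * y)) with hfdef
    have hf : Continuous f := Complex.continuous_conj.comp (continuous_exp_I_mul _)
    set J : ℝ := ∫ y in Icc (-N) 0, ‖f y‖ ^ 2 with hJdef
    have hnorm : ∀ y : ℝ, ‖f y‖ ^ 2 = Real.exp (2 * z.im * y) := fun y => by
      rw [hfdef]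
      simp only [RCLike.norm_conj]
      rw [norm_exp_I_mul, sq, ← Real.exp_add]
      congr 1; simp; ring
    have hJ : J = (1 - Real.exp (-(2 * z.im) * N)) / (2 * z.im) := by
      rw [hJdef]
      simp_rw [hnorm]
      rw [integral_Icc_eq_integral_Ioc, ← intervalIntegral.integral_of_le (by linarith)]
      have : (2 * z.im) ≠ 0 := by positivity
      rw [intervalIntegral.integral_comp_mul_left (fun x => Real.exp x) this, integral_exp]
      simp; field_simp
    have hinp : inp N f z = (J : ℂ) := by
      rw [hJdef, ← integral_complex_ofReal]
      refine integral_congr_ae (ae_of_all _ fun y => ?_)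
      simp only [hfdef]
      rw [mul_comm, Complex.mul_conj, Complex.normSq_eq_norm_sq, RCLike.norm_conj]
    have h1 := (response_transform hK h3 h5 N hf hz).2
    change ‖tr N f z‖ ^ 2 ≤ _ at h1
    rw [hall N f hf hz] at h1
    simp only at h1
    rw [hinp, norm_mul, Complex.norm_real, mul_pow, Real.norm_eq_abs, sq_abs,
      ← hJdef] at h1
    have hJpos : 0 < J := by
      rw [hJ]
      refine div_pos (sub_pos.2 ?_) (by positivity)
      rw [Real.exp_lt_one_iff]
      have := mul_pos hz hN
      linarith
    have h2 : ‖Θ z‖ ^ 2 * J ≤ 1 / (2 * z.im) := by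
      refine le_of_mul_le_mul_left ?_ hJpos
      calc J * (‖Θ z‖ ^ 2 * J) = ‖Θ z‖ ^ 2 * J ^ 2 := by ring
        _ ≤ _ := h1
    rw [hJ, ← mul_div_assoc, div_le_div_iff_of_pos_right (by positivity)] at h2
    exact h2
  have hlim : Tendsto (fun N : ℝ => ‖Θ z‖ ^ 2 * (1 - Real.exp (-(2 * z.im) * N))) atTop
      (𝓝 (‖Θ z‖ ^ 2 * (1 - 0))) := by
    refine Tendsto.const_mul _ (tendsto_const_nhds.sub ?_)
    refine Real.tendsto_exp_atBot.comp ?_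
    exact tendsto_id.const_mul_atTop_of_neg (by linarith)
  have h1 : ‖Θ z‖ ^ 2 * (1 - 0) ≤ 1 := le_of_tendsto hlim
    ((eventually_gt_atTop 0).mono fun N hN => hbound N hN)
  nlinarith [norm_nonneg (Θ z)]

end Schur

/-! ### Boundary densities and the integral equations -/

theorem setIntegral_Iio_eq_intervalIntegral {F : Type*} [NormedAddCommGroup F] [NormedSpace ℝ F]
    {g : ℝ → F} {a t : ℝ} (hat : a ≤ t) (hg : ∀ y < a, g y = 0) :
    ∫ y in Iio t, g y = ∫ y in a..t, g y := by
  rw [intervalIntegral.integral_of_le hat, ← integral_Iic_eq_integral_Iio,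
    ← integral_Icc_eq_integral_Ioc]
  refine setIntegral_eq_of_subset_of_forall_sdiff_eq_zero measurableSet_Iic
    Icc_subset_Iic_self fun y hy => hg y ?_
  by_contra h
  exact hy.2 ⟨not_lt.1 h, hy.1⟩

theorem integrableOn_Iio_of_eq_zero {F : Type*} [NormedAddCommGroup F] {g : ℝ → F} {a t : ℝ}
    (hI : IntegrableOn g (Icc a t)) (hg : ∀ y < a, g y = 0) : IntegrableOn g (Iio t) := by
  refine IntegrableOn.of_forall_sdiff_eq_zero (hI.mono_set inter_subset_left)
    measurableSet_Iio (s := Icc a t ∩ Iio t) fun y hy => hg y ?_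
  by_contra h
  exact hy.2 ⟨⟨not_lt.1 h, (mem_Iio.1 hy.1).le⟩, hy.1⟩

/-- The solution of the equation obtained by differentiating the integral equation with
respect to `x`, normalised by the boundary value `1` at `x = t`. -/
structure IsBoundaryDensity (K : ℝ → ℝ) (σ t : ℝ) (φ : ℝ → ℝ) : Prop where
  continuous : Continuous φ
  eq_zero : ∀ x < -t, φ x = 0
  eq : ∀ x, φ x = -σ * K (x + t) + σ * ∫ y in Iio t, K (x + y) * φ y

section

variable {K : ℝ → ℝ} {σ t c M : ℝ} {φ : ℝ → ℝ}

/-- For `t ≤ 0` the integral term vanishes by support and the density is explicit. For `t > 0`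
everything lives on `[-t, t]`, where the Hankel equation is solvable. -/
theorem exists_isBoundaryDensity (hK : Continuous K) (h3 : CondK3 K) (h5 : CondK5 K ⊤)
    (hσ : |σ| = 1) (t : ℝ) : ∃ φ, IsBoundaryDensity K σ t φ := by
  rcases le_or_gt t 0 with ht | ht
  · refine ⟨fun x => -σ * K (x + t), ?_, fun x hx => ?_, fun x => ?_⟩
    · exact continuous_const.mul (hK.comp (continuous_id.add continuous_const))
    · rw [h3 _ (by linarith), mul_zero]
    · rw [left_eq_add]
      refine mul_eq_zero_of_right _ (setIntegral_eq_zero_of_forall_eq_zero fun y hy => ?_)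
      rw [h3 (y + t) (by linarith [mem_Iio.1 hy]), mul_zero, mul_zero]
  · obtain ⟨u, hu, hueq⟩ := exists_solution_hankel hK h3 h5 ht (σ := (σ : ℂ))
      (by rwa [Complex.norm_real]) (g := fun x : ℝ => ((-σ * K (x + t) : ℝ) : ℂ))
      (Complex.continuous_ofReal.comp
        (continuous_const.mul (hK.comp (continuous_id.add continuous_const))))
    have hu0 : ∀ x < -t, u x = 0 := fun x hx => by
      rw [hueq, h3 _ (by linarith), setIntegral_eq_zero_of_forall_eq_zero]
      · simp
      · intro y hy
        rw [h3 (x + y) (by linarith [hy.2])]; simp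
    refine ⟨fun x => (u x).re, Complex.continuous_re.comp hu, fun x hx => by simp [hu0 x hx],
      fun x => ?_⟩
    have hI : IntegrableOn (fun y => (K (x + y) : ℂ) * u y) (Icc (-t) t) :=
      ((Complex.continuous_ofReal.comp
        (hK.comp (continuous_const.add continuous_id))).mul hu).integrableOn_Icc
    have h1 := congrArg Complex.re (hueq x)
    rw [Complex.add_re, Complex.ofReal_re, Complex.re_ofReal_mul] at h1
    rw [h1]
    congr 2
    have h2 := Complex.reCLM.integral_comp_comm hI
    simp only [Complex.reCLM_apply, Complex.re_ofReal_mul] at h2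
    rw [← h2, setIntegral_Iio_eq_intervalIntegral (a := -t) (by linarith)
      (fun y hy => by simp [hu0 y hy]), intervalIntegral.integral_of_le (by linarith),
      integral_Icc_eq_integral_Ioc]

namespace IsBoundaryDensity

theorem integrableOn_mul (h : IsBoundaryDensity K σ t φ) {g : ℝ → ℝ} (hg : Continuous g) :
    IntegrableOn (fun y => g y * φ y) (Iio t) :=
  integrableOn_Iio_of_eq_zero (a := -t) (hg.mul h.continuous).integrableOn_Icc
    fun y hy => by simp [h.eq_zero y hy]

theorem integrableOn (h : IsBoundaryDensity K σ t φ) : IntegrableOn φ (Iio t) := by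
  simpa using h.integrableOn_mul (g := fun _ => 1) continuous_const

theorem integrableOn_mul_complex (h : IsBoundaryDensity K σ t φ) {g : ℝ → ℂ} (hg : Continuous g) :
    IntegrableOn (fun y => (φ y : ℂ) * g y) (Iio t) :=
  integrableOn_Iio_of_eq_zero (a := -t)
    ((Complex.continuous_ofReal.comp h.continuous).mul hg).integrableOn_Icc
    fun y hy => by simp [h.eq_zero y hy]

/-- The primitive of the density with value `1` at `t`. -/
def primitive (t : ℝ) (φ : ℝ → ℝ) (x : ℝ) : ℝ := 1 + ∫ s in t..x, φ s

/-- The constant value of the primitive far to the left. -/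
def leftValue (t : ℝ) (φ : ℝ → ℝ) : ℝ := 1 - ∫ y in Iio t, φ y

theorem hasDerivAt_primitive (h : IsBoundaryDensity K σ t φ) (x : ℝ) :
    HasDerivAt (primitive t φ) (φ x) x :=
  (h.continuous.integral_hasStrictDerivAt t x).hasDerivAt.const_add 1

theorem continuous_primitive (h : IsBoundaryDensity K σ t φ) : Continuous (primitive t φ) :=
  continuous_iff_continuousAt.2 fun x => (h.hasDerivAt_primitive x).continuousAt

/-- Integrating the density equation from far to the left up to `x`, and integrating by parts with
the primitive `k` of `K`, cancels all the terms containing `k`. -/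
theorem primitive_add_integral (hK : Continuous K) (h3 : CondK3 K)
    (h : IsBoundaryDensity K σ t φ) (x : ℝ) :
    primitive t φ x + σ * ∫ y in Iio t, K (x + y) * primitive t φ y = leftValue t φ := by
  -- Far enough left that `φ` and `K(x + ·)` both vanish below `a`, and that `k` vanishes at `x + a`
  -- and `a + t`.
  set a : ℝ := -|x| - |t| with ha
  have hat : a ≤ t := by linarith [neg_abs_le t, abs_nonneg x]
  have hat' : a ≤ -t := by linarith [le_abs_self t, abs_nonneg x]
  have hax : a ≤ x := by linarith [neg_abs_le x, abs_nonneg t]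
  have hax' : a ≤ -x := by linarith [le_abs_self x, abs_nonneg t]
  set k : ℝ → ℝ := fun u => ∫ s in (0 : ℝ)..u, K s with hk
  have hkd : ∀ u, HasDerivAt k (K u) u := fun u => (hK.integral_hasStrictDerivAt 0 u).hasDerivAt
  have hk0 : ∀ u ≤ 0, k u = 0 := fun u hu => by
    rw [hk]; simp only
    rw [intervalIntegral.integral_symm, neg_eq_zero, intervalIntegral.integral_of_le hu,
      integral_Ioc_eq_integral_Ioo]
    exact setIntegral_eq_zero_of_forall_eq_zero fun y hy => h3 y hy.2
  have hksub : ∀ y, ∫ s in a..x, K (s + y) = k (x + y) - k (a + y) := fun y => by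
    rw [intervalIntegral.integral_comp_add_right, hk]; simp only
    rw [intervalIntegral.integral_interval_sub_left] <;> exact hK.intervalIntegrable _ _
  have hC : leftValue t φ = primitive t φ a := by
    unfold leftValue primitive
    rw [setIntegral_Iio_eq_intervalIntegral hat (fun y hy => h.eq_zero y (by linarith)),
      intervalIntegral.integral_symm, sub_neg_eq_add]
  have hΦt : primitive t φ t = 1 := by simp [primitive]
  have e1 : ∫ y in Iio t, K (x + y) * primitive t φ y = ∫ y in a..t, primitive t φ y * K (x + y) := by
    rw [setIntegral_Iio_eq_intervalIntegral hat
      (fun y hy => by rw [h3 (x + y) (by linarith), zero_mul])]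
    simp_rw [mul_comm]
  have e2 : ∫ y in a..t, primitive t φ y * K (x + y) =
      k (x + t) - ∫ y in a..t, φ y * k (x + y) := by
    rw [intervalIntegral.integral_mul_deriv_eq_deriv_mul
      (v := fun y => k (x + y)) (v' := fun y => K (x + y)) (u' := φ) (fun y _ => h.hasDerivAt_primitive y)
      (fun y _ => by simpa using (hkd (x + y)).comp_const_add x y)
      (h.continuous.intervalIntegrable _ _)
      ((hK.comp (continuous_const.add continuous_id)).intervalIntegrable _ _), hΦt,
      hk0 (x + a) (by linarith), one_mul, mul_zero, sub_zero]
  have e3 : primitive t φ x - primitive t φ a = ∫ s in a..x, φ s := by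
    unfold primitive
    rw [add_sub_add_left_eq_sub, intervalIntegral.integral_interval_sub_left] <;>
      exact h.continuous.intervalIntegrable _ _
  have e4 : ∫ s in a..x, φ s = -σ * k (x + t) + σ * ∫ y in a..t, φ y * k (x + y) := by
    have e5 : ∀ s, φ s = -σ * K (s + t) + σ * ∫ y in a..t, K (s + y) * φ y := fun s => by
      rw [h.eq s, setIntegral_Iio_eq_intervalIntegral hat
        (fun y hy => by rw [h.eq_zero y (by linarith), mul_zero])]
    have hcont : Continuous fun s => ∫ y in a..t, K (s + y) * φ y := by
      have := h.continuous
      fun_prop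
    have hF : Continuous (Function.uncurry fun s y => K (s + y) * φ y) :=
      (hK.comp (continuous_fst.add continuous_snd)).mul (h.continuous.comp continuous_snd)
    rw [intervalIntegral.integral_congr (g := fun s => -σ * K (s + t) +
      σ * ∫ y in a..t, K (s + y) * φ y) fun s _ => e5 s, intervalIntegral.integral_add,
      intervalIntegral.integral_const_mul, intervalIntegral.integral_const_mul, hksub,
      hk0 (a + t) (by linarith), sub_zero, intervalIntegral_intervalIntegral_swap]
    · congr 2
      refine intervalIntegral.integral_congr_ae (ae_of_all _ fun y hy => ?_)
      rw [uIoc_of_le hat] at hy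
      rw [intervalIntegral.integral_mul_const, hksub, hk0 (a + y) (by linarith [hy.2]), sub_zero,
        mul_comm]
    · exact (hF.continuousOn.integrableOn_compact (isCompact_uIcc.prod isCompact_uIcc)).mono_set
        (prod_mono uIoc_subset_uIcc uIoc_subset_uIcc)
    · exact (continuous_const.mul
        (hK.comp (continuous_id.add continuous_const))).intervalIntegrable _ _
    · exact (continuous_const.mul hcont).intervalIntegrable _ _
  rw [e1, e2, hC]
  linarith [e3, e4]

theorem solvesIntegralEq (hK : Continuous K) (h3 : CondK3 K) (h : IsBoundaryDensity K σ t φ)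
    (hC : leftValue t φ ≠ 0) :
    SolvesIntegralEq K σ t fun x => ((primitive t φ x / leftValue t φ : ℝ) : ℂ) := by
  refine ⟨(Complex.continuous_ofReal.comp
    (h.continuous_primitive.div_const _)).locallyIntegrable, fun x => ?_⟩
  have e : ∀ y, (K (x + y) : ℂ) * ((primitive t φ y / leftValue t φ : ℝ) : ℂ) =
      (((K (x + y) * primitive t φ y) / leftValue t φ : ℝ) : ℂ) := fun y => by
    push_cast; ring
  simp_rw [e]
  rw [integral_complex_ofReal, integral_div]
  have := h.primitive_add_integral hK h3 x
  norm_cast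
  field_simp
  linarith

end IsBoundaryDensity

theorem integrableOn_kernel_mul (hK : Continuous K) (h3 : CondK3 K) {f : ℝ → ℂ}
    (hf : LocallyIntegrable f volume) (t x : ℝ) :
    IntegrableOn (fun y => (K (x + y) : ℂ) * f y) (Iio t) := by
  refine integrableOn_Iio_of_eq_zero (a := -x) ?_ fun y hy => by
    rw [h3 (x + y) (by linarith)]; simp
  exact (hf.integrableOn_isCompact isCompact_Icc).continuousOn_mul
    (Complex.continuous_ofReal.comp (hK.comp (continuous_const.add continuous_id))).continuousOn
    isCompact_Icc

/-- A homogeneous solution vanishes left of `-t`. The equation makes it continuous, hence square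
integrable on `(-∞, t)`, so unless it is zero there it is an eigenfunction with eigenvalue `-σ`,
against (K5). Zero on `(-∞, t)`, it vanishes everywhere by the equation. -/
theorem eq_zero_of_homogeneous (hK : Continuous K) (h3 : CondK3 K) (h5 : CondK5 K ⊤) {σ : ℂ}
    (hσ : σ = 1 ∨ σ = -1) {d : ℝ → ℂ} (hd : LocallyIntegrable d volume)
    (heq : ∀ x, d x + σ * ∫ y in Iio t, (K (x + y) : ℂ) * d y = 0) : d = 0 := by
  have hσ2 : σ * σ = 1 := by rcases hσ with h | h <;> simp [h]
  have hzero : ∀ x < -t, d x = 0 := fun x hx => by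
    have := heq x
    rwa [setIntegral_eq_zero_of_forall_eq_zero, mul_zero, add_zero] at this
    intro y hy
    rw [h3 (x + y) (by linarith [mem_Iio.1 hy])]; simp
  suffices hae : d =ᵐ[volume.restrict (Iio t)] 0 by
    ext x
    have h1 : ∫ y in Iio t, (K (x + y) : ℂ) * d y = 0 := by
      rw [← integral_zero ℝ ℂ (μ := volume.restrict (Iio t))]
      refine integral_congr_ae ?_
      filter_upwards [hae] with y hy
      rw [hy]; simp
    simpa [h1] using heq x
  rcases lt_or_ge t 0 with ht | ht
  · rw [EventuallyEq, ae_restrict_iff' measurableSet_Iio]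
    exact ae_of_all _ fun y hy => hzero y (by linarith [mem_Iio.1 hy])
  by_contra hne
  have hcont : Continuous d := by
    have : d = fun x => -(σ * ∫ y in Icc (-t) t, (K (x + y) : ℂ) * d y) := by
      ext x
      rw [eq_neg_of_add_eq_zero_left (heq x), setIntegral_Iio_eq_intervalIntegral (a := -t)
        (by linarith) (fun y hy => by simp [hzero y hy]),
        intervalIntegral.integral_of_le (by linarith), integral_Icc_eq_integral_Ioc]
    rw [this]
    exact (continuous_const.mul (continuous_integral_translate hK
      (hd.integrableOn_isCompact isCompact_Icc))).neg
  have hL : MemLp d 2 (volume.restrict (Iio t)) := by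
    rw [memLp_two_iff_integrable_sq_norm hcont.aestronglyMeasurable]
    exact integrableOn_Iio_of_eq_zero (a := -t) (hcont.norm.pow 2).integrableOn_Icc
      fun y hy => by simp [hzero y hy]
  have heig : IsEigenvalueTruncOp K t (-σ) := by
    refine ⟨d, hL, hne, ?_⟩
    rw [EventuallyEq, ae_restrict_iff' measurableSet_Iio]
    refine ae_of_all _ fun x hx => ?_
    unfold truncOp
    rw [indicator_of_mem hx]
    linear_combination σ * heq x - (∫ y in Iio t, (K (x + y) : ℂ) * d y) * hσ2
  have := h5.2 t ht (EReal.coe_lt_top t)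
  rcases hσ with h | h
  · rw [h] at heig; exact this.2 heig
  · rw [h, neg_neg] at heig; exact this.1 heig

theorem solvesIntegralEq_unique (hK : Continuous K) (h3 : CondK3 K) (h5 : CondK5 K ⊤) {σ : ℂ}
    (hσ : σ = 1 ∨ σ = -1) {f g : ℝ → ℂ} (hf : SolvesIntegralEq K σ t f)
    (hg : SolvesIntegralEq K σ t g) : f = g := by
  rw [← sub_eq_zero]
  refine eq_zero_of_homogeneous hK h3 h5 (t := t) hσ (hf.1.sub hg.1) fun x => ?_
  simp only [Pi.sub_apply, mul_sub]
  rw [integral_sub (integrableOn_kernel_mul hK h3 hf.1 t x) (integrableOn_kernel_mul hK h3 hg.1 t x)]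
  linear_combination hf.2 x - hg.2 x

end

/-- The entire function `e^{izt} - ∫_{-∞}^t φ(y) e^{izy} dy`. -/
def edge (t : ℝ) (φ : ℝ → ℝ) (z : ℂ) : ℂ :=
  Complex.exp (Complex.I * z * t) - ∫ y in Iio t, (φ y : ℂ) * Complex.exp (Complex.I * z * y)

/-- The combination `q(z) - σ Θ(z) q(-z)` with `q` the entire function `edge`. -/
def wave (σ t : ℝ) (φ : ℝ → ℝ) (Θ : ℂ → ℂ) (z : ℂ) : ℂ :=
  edge t φ z - σ * Θ z * edge t φ (-z)

/-! ### Transforms of the densities and their growth -/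

namespace IsBoundaryDensity

variable {K : ℝ → ℝ} {σ t c M B : ℝ} {φ : ℝ → ℝ} {Θ : ℂ → ℂ}

theorem exists_growth (h : IsBoundaryDensity K σ t φ) (hσ : |σ| = 1)
    (hM : ∀ x, |K x| ≤ M * Real.exp (c * x)) :
    ∃ B : ℝ, 0 ≤ B ∧ ∀ x, |φ x| ≤ B * Real.exp (c * x) := by
  have hM0 : 0 ≤ M := by
    have := (abs_nonneg _).trans (hM 0)
    simpa using this
  have hI : IntegrableOn (fun y => Real.exp (c * y) * |φ y|) (Iio t) := by
    have := (h.integrableOn_mul (g := fun y => Real.exp (c * y)) (by fun_prop)).norm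
    simpa [abs_mul, IntegrableOn] using this
  refine ⟨M * Real.exp (c * t) + M * ∫ y in Iio t, Real.exp (c * y) * |φ y|, ?_, fun x => ?_⟩
  · have : 0 ≤ ∫ y in Iio t, Real.exp (c * y) * |φ y| := integral_nonneg fun _ => by positivity
    positivity
  · have h1 : ‖∫ y in Iio t, K (x + y) * φ y‖ ≤
        (M * ∫ y in Iio t, Real.exp (c * y) * |φ y|) * Real.exp (c * x) := by
      rw [← integral_const_mul, ← integral_mul_const]
      refine norm_integral_le_of_norm_le ((hI.const_mul M).mul_const _) (ae_of_all _ fun y => ?_)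
      rw [norm_mul, Real.norm_eq_abs, Real.norm_eq_abs]
      calc |K (x + y)| * |φ y| ≤ (M * Real.exp (c * (x + y))) * |φ y| := by
            gcongr; exact hM _
        _ = _ := by rw [mul_add, Real.exp_add]; ring
    have h2 : |K (x + t)| ≤ (M * Real.exp (c * t)) * Real.exp (c * x) := by
      refine (hM _).trans_eq ?_
      rw [mul_add, Real.exp_add]; ring
    rw [h.eq x]
    refine (abs_add_le _ _).trans ?_
    rw [abs_mul, abs_mul, abs_neg, hσ, one_mul, one_mul, add_mul]
    exact add_le_add h2 (by simpa only [Real.norm_eq_abs] using h1)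

theorem differentiable_edge (h : IsBoundaryDensity K σ t φ) : Differentiable ℂ (edge t φ) := by
  refine Differentiable.sub (by fun_prop) (differentiable_transform ?_ fun z => ?_)
  · exact (Complex.continuous_ofReal.comp h.continuous).aestronglyMeasurable
  · exact h.integrableOn_mul_complex (continuous_exp_I_mul z)

theorem _root_.InnerFamily.conj_edge (t : ℝ) (φ : ℝ → ℝ) (z : ℂ) :
    conj (edge t φ (conj z)) = edge t φ (-z) := by
  have e : ∀ y : ℝ, conj (Complex.exp (Complex.I * conj z * y)) =
      Complex.exp (Complex.I * -z * y) := fun y => by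
    rw [← Complex.exp_conj]; simp
  unfold edge
  rw [map_sub, e, ← integral_conj]
  simp_rw [map_mul, Complex.conj_ofReal, e]

theorem integral_abs_nonneg (t : ℝ) (φ : ℝ → ℝ) : 0 ≤ ∫ y in Iio t, |φ y| :=
  integral_nonneg fun _ => abs_nonneg _

theorem norm_edge_neg_le (h : IsBoundaryDensity K σ t φ) {z : ℂ} (hz : 0 ≤ z.im) :
    ‖edge t φ (-z)‖ ≤ (1 + ∫ y in Iio t, |φ y|) * Real.exp (t * z.im) := by
  unfold edge
  refine (norm_sub_le _ _).trans ?_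
  rw [add_mul, one_mul, norm_exp_I_mul]
  refine add_le_add (le_of_eq (by congr 1; simp; ring)) ?_
  rw [← integral_mul_const]
  refine norm_integral_le_of_norm_le (h.integrableOn.abs.mul_const _)
    ((ae_restrict_iff' measurableSet_Iio).2 (ae_of_all _ fun y hy => ?_))
  rw [norm_mul, norm_exp_I_mul, Complex.norm_real, Real.norm_eq_abs]
  gcongr
  simp only [Complex.neg_im, neg_mul, neg_neg]
  rw [mul_comm]
  exact mul_le_mul_of_nonneg_right (mem_Iio.1 hy).le hz

theorem norm_edge_le (h : IsBoundaryDensity K σ t φ) (z : ℂ) :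
    ‖edge t φ z‖ ≤ (1 + ∫ y in Iio t, |φ y|) * Real.exp (|t| * |z.im|) := by
  unfold edge
  have aux : ∀ y : ℝ, |y| ≤ |t| → Real.exp (-(z.im * y)) ≤ Real.exp (|t| * |z.im|) := fun y hy => by
    apply Real.exp_le_exp.2
    refine (neg_le_abs _).trans ?_
    rw [abs_mul, mul_comm]
    gcongr
  refine (norm_sub_le _ _).trans ?_
  rw [add_mul, one_mul, norm_exp_I_mul]
  refine add_le_add (aux t le_rfl) ?_
  rw [← integral_mul_const]
  refine norm_integral_le_of_norm_le (h.integrableOn.abs.mul_const _)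
    ((ae_restrict_iff' measurableSet_Iio).2 (ae_of_all _ fun y hy => ?_))
  rw [norm_mul, norm_exp_I_mul, Complex.norm_real, Real.norm_eq_abs]
  by_cases hyt : y < -t
  · simp [h.eq_zero y hyt]
  · refine mul_le_mul_of_nonneg_left (aux y ?_) (abs_nonneg _)
    refine abs_le.2 ⟨?_, (mem_Iio.1 hy).le.trans (le_abs_self t)⟩
    linarith [le_abs_self t, not_lt.1 hyt]

theorem integrable_transform (h : IsBoundaryDensity K σ t φ)
    (hB : ∀ x, |φ x| ≤ B * Real.exp (c * x)) {z : ℂ} (hz : c < z.im) :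
    Integrable fun x : ℝ => (φ x : ℂ) * Complex.exp (Complex.I * z * x) :=
  integrable_mul_exp (a := -t) (Complex.continuous_ofReal.comp h.continuous).aestronglyMeasurable
    (fun x hx => by simp [h.eq_zero x hx]) (fun x _ => by simpa using hB x) hz

/-- The Fourier transform of the density equation. -/
theorem transform_eq (hK : Continuous K) (h3 : CondK3 K)
    (hM : ∀ x, |K x| ≤ M * Real.exp (c * x)) (h : IsBoundaryDensity K σ t φ)
    (hB : ∀ x, |φ x| ≤ B * Real.exp (c * x)) {z : ℂ} (hz : c < z.im) :
    Complex.exp (Complex.I * z * t) +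
      ∫ x in Ioi t, (φ x : ℂ) * Complex.exp (Complex.I * z * x) =
        edge t φ z - σ * fourierIntegral K z * edge t φ (-z) := by
  have hI := h.integrable_transform hB hz
  have hKI := integrable_kernel_exp hK h3 hM hz
  have hνI := h.integrableOn_mul_complex (continuous_exp_I_mul (-z))
  have hH := integrable_hankel_mul_exp hK hKI hνI
  have h1 : ∀ x : ℝ, (φ x : ℂ) * Complex.exp (Complex.I * z * x) =
      (-σ * Complex.exp (Complex.I * -z * t)) *
        ((K (x + t) : ℂ) * Complex.exp (Complex.I * z * (x + t : ℝ))) +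
      σ * ((∫ y in Iio t, (K (x + y) : ℂ) * φ y) * Complex.exp (Complex.I * z * x)) := by
    intro x
    have e : Complex.exp (Complex.I * z * x) = Complex.exp (Complex.I * -z * t) *
        Complex.exp (Complex.I * z * (x + t : ℝ)) := by
      rw [← Complex.exp_add]; congr 1; push_cast; ring
    have e2 : (φ x : ℂ) = -σ * K (x + t) + σ * ∫ y in Iio t, (K (x + y) : ℂ) * φ y := by
      simp_rw [← Complex.ofReal_mul]
      rw [integral_complex_ofReal]
      exact_mod_cast congrArg Complex.ofReal (h.eq x)
    rw [e2, add_mul, mul_assoc (σ : ℂ)]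
    congr 1
    rw [e]; ring
  have h2 : ∫ x : ℝ, (φ x : ℂ) * Complex.exp (Complex.I * z * x) =
      -σ * fourierIntegral K z * edge t φ (-z) := by
    simp_rw [h1]
    rw [integral_add ((hKI.comp_add_right t).const_mul _) (hH.const_mul _), integral_const_mul,
      integral_const_mul, integral_hankel_mul_exp hK hKI hνI,
      integral_add_right_eq_self (fun x : ℝ => (K x : ℂ) * Complex.exp (Complex.I * z * x)) t,
      ← fourierIntegral_eq, edge]
    ring
  have h3 : ∫ x in Ioi t, (φ x : ℂ) * Complex.exp (Complex.I * z * x) =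
      (∫ x : ℝ, (φ x : ℂ) * Complex.exp (Complex.I * z * x)) -
        ∫ x in Iio t, (φ x : ℂ) * Complex.exp (Complex.I * z * x) := by
    rw [← integral_Iic_eq_integral_Iio,
      ← intervalIntegral.integral_Iic_add_Ioi (b := t) hI.integrableOn hI.integrableOn]
    ring
  rw [h3, h2, edge, edge]
  ring

theorem norm_transform_Ioi_le (hB : ∀ x, |φ x| ≤ B * Real.exp (c * x)) {z : ℂ} (hz : c < z.im) :
    ‖∫ x in Ioi t, (φ x : ℂ) * Complex.exp (Complex.I * z * x)‖ ≤
      B * Real.exp (c * t) / (z.im - c) * Real.exp (-(t * z.im)) := by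
  have e : B * Real.exp (c * t) / (z.im - c) * Real.exp (-(t * z.im)) =
      ∫ x in Ioi t, B * Real.exp ((c - z.im) * x) := by
    rw [integral_const_mul, integral_exp_mul_Ioi (by linarith),
      show (c - z.im) * t = c * t + -(t * z.im) by ring, Real.exp_add]
    have : z.im - c ≠ 0 := by linarith
    have : c - z.im ≠ 0 := by linarith
    field_simp
    ring
  rw [e]
  refine norm_integral_le_of_norm_le ((integrableOn_exp_mul_Ioi (by linarith) t).const_mul B)
    (ae_of_all _ fun x => ?_)
  rw [norm_mul, norm_exp_I_mul, Complex.norm_real, Real.norm_eq_abs]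
  calc |φ x| * Real.exp (-(z.im * x)) ≤ (B * Real.exp (c * x)) * Real.exp (-(z.im * x)) := by
        gcongr; exact hB x
    _ = _ := by rw [mul_assoc, ← Real.exp_add]; congr 2; ring

theorem wave_eq (hK : Continuous K) (h3 : CondK3 K)
    (hM : ∀ x, |K x| ≤ M * Real.exp (c * x)) (h : IsBoundaryDensity K σ t φ)
    (hB : ∀ x, |φ x| ≤ B * Real.exp (c * x))
    (hΘ : ∀ z : ℂ, c < z.im → Θ z = fourierIntegral K z) {z : ℂ} (hz : c < z.im) :
    wave σ t φ Θ z = Complex.exp (Complex.I * z * t) +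
      ∫ x in Ioi t, (φ x : ℂ) * Complex.exp (Complex.I * z * x) := by
  rw [h.transform_eq hK h3 hM hB hz, wave, hΘ z hz]

/-- The combination decays like `e^{-t Im z}` although its two terms separately need not: high up it
is a transform over `(t, ∞)`. -/
theorem exists_norm_wave_le (hK : Continuous K) (h3 : CondK3 K)
    (hM : ∀ x, |K x| ≤ M * Real.exp (c * x)) (hσ : |σ| = 1) (h : IsBoundaryDensity K σ t φ)
    (hΘ1 : ∀ z : ℂ, 0 < z.im → ‖Θ z‖ ≤ 1)
    (hΘ : ∀ z : ℂ, c < z.im → Θ z = fourierIntegral K z) :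
    ∃ C : ℝ, ∀ z : ℂ, 0 < z.im → ‖wave σ t φ Θ z‖ ≤ C * Real.exp (-(t * z.im)) := by
  obtain ⟨B, hB0, hB⟩ := h.exists_growth hσ hM
  set I := 1 + ∫ y in Iio t, |φ y| with hI
  have hI0 : 0 ≤ I := by have := integral_abs_nonneg t φ; positivity
  refine ⟨max (1 + B * Real.exp (c * t)) (2 * I * Real.exp (2 * (|t| * (c + 1)))), fun z hz => ?_⟩
  rcases le_or_gt (c + 1) z.im with hz1 | hz1
  · refine le_trans ?_ (mul_le_mul_of_nonneg_right (le_max_left _ _) (Real.exp_nonneg _))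
    rw [h.wave_eq hK h3 hM hB hΘ (by linarith), add_mul, one_mul]
    refine (norm_add_le _ _).trans (add_le_add (le_of_eq ?_) ?_)
    · rw [norm_exp_I_mul, mul_comm]
    · refine (norm_transform_Ioi_le hB (by linarith)).trans ?_
      gcongr
      exact div_le_self (by positivity) (by linarith)
  -- In the strip `0 < Im z < c + 1` the exponentials are bounded above and below, so the crude
  -- bound with `‖Θ‖ ≤ 1` suffices.
  · refine le_trans ?_ (mul_le_mul_of_nonneg_right (le_max_right _ _) (Real.exp_nonneg _))
    have hA : Real.exp (|t| * |z.im|) ≤ Real.exp (|t| * (c + 1)) := by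
      apply Real.exp_le_exp.2
      rw [abs_of_pos hz]
      gcongr
    have h1 := (h.norm_edge_le z).trans (mul_le_mul_of_nonneg_left hA hI0)
    have h2 : ‖edge t φ (-z)‖ ≤ I * Real.exp (|t| * (c + 1)) := by
      refine (h.norm_edge_le (-z)).trans (mul_le_mul_of_nonneg_left ?_ hI0)
      simpa using hA
    have h4 : ‖wave σ t φ Θ z‖ ≤ 2 * I * Real.exp (|t| * (c + 1)) := by
      unfold wave
      refine (norm_sub_le _ _).trans ?_
      rw [norm_mul, norm_mul, Complex.norm_real, Real.norm_eq_abs, hσ, one_mul]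
      have := mul_le_mul (hΘ1 z hz) h2 (norm_nonneg _) zero_le_one
      linarith
    refine h4.trans ?_
    rw [mul_assoc (2 * I), ← Real.exp_add]
    gcongr
    have : t * z.im ≤ |t| * (c + 1) := by
      refine (le_abs_self _).trans ?_
      rw [abs_mul, abs_of_pos hz]
      gcongr
    linarith

theorem tendsto_wave (hK : Continuous K) (h3 : CondK3 K)
    (hM : ∀ x, |K x| ≤ M * Real.exp (c * x)) (hσ : |σ| = 1) (h : IsBoundaryDensity K σ t φ)
    (hΘ : ∀ z : ℂ, c < z.im → Θ z = fourierIntegral K z) :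
    Tendsto (fun y : ℝ => wave σ t φ Θ (y * Complex.I) * Real.exp (t * y)) atTop (𝓝 1) := by
  obtain ⟨B, hB0, hB⟩ := h.exists_growth hσ hM
  rw [tendsto_iff_norm_sub_tendsto_zero]
  have hlim : Tendsto (fun y : ℝ => B * Real.exp (c * t) / (y - c)) atTop (𝓝 0) :=
    tendsto_const_nhds.div_atTop (tendsto_atTop_add_const_right _ _ tendsto_id)
  refine squeeze_zero' (Eventually.of_forall fun _ => norm_nonneg _) ?_ hlim
  filter_upwards [eventually_gt_atTop c] with y hy
  have hyim : ((y : ℂ) * Complex.I).im = y := by simp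
  have e1 : Complex.exp (Complex.I * (y * Complex.I) * t) * Real.exp (t * y) = 1 := by
    rw [Complex.ofReal_exp, ← Complex.exp_add, ← Complex.exp_zero]
    congr 1
    push_cast
    linear_combination (y * t : ℂ) * Complex.I_mul_I
  rw [h.wave_eq hK h3 hM hB hΘ (by rwa [hyim]), add_mul, e1, add_sub_cancel_left, norm_mul,
    Complex.norm_real, Real.norm_of_nonneg (Real.exp_nonneg _)]
  have := norm_transform_Ioi_le (t := t) hB (z := y * Complex.I) (by rwa [hyim])
  rw [hyim] at this
  calc _ ≤ (B * Real.exp (c * t) / (y - c) * Real.exp (-(t * y))) * Real.exp (t * y) := by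
        gcongr
    _ = _ := by rw [mul_assoc, ← Real.exp_add, neg_add_cancel, Real.exp_zero, mul_one]

theorem tendsto_edge (hM : ∀ x, |K x| ≤ M * Real.exp (c * x)) (hσ : |σ| = 1)
    (h : IsBoundaryDensity K σ t φ) :
    Tendsto (fun y : ℝ => edge t φ (-(y * Complex.I)) * Real.exp (-(t * y))) atTop (𝓝 1) := by
  obtain ⟨B, hB0, hB⟩ := h.exists_growth hσ hM
  rw [tendsto_iff_norm_sub_tendsto_zero]
  have hlim : Tendsto (fun y : ℝ => B * Real.exp (c * t) / (y + c)) atTop (𝓝 0) :=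
    tendsto_const_nhds.div_atTop (tendsto_atTop_add_const_right _ _ tendsto_id)
  refine squeeze_zero' (Eventually.of_forall fun _ => norm_nonneg _) ?_ hlim
  filter_upwards [eventually_gt_atTop (-c)] with y hy
  have e1 : Complex.exp (Complex.I * (-(y * Complex.I)) * t) * Real.exp (-(t * y)) = 1 := by
    rw [Complex.ofReal_exp, ← Complex.exp_add, ← Complex.exp_zero]
    congr 1
    push_cast
    linear_combination (-y * t : ℂ) * Complex.I_mul_I
  have e2 : B * Real.exp (c * t) / (y + c) =
      (∫ x in Iic t, B * Real.exp ((y + c) * x)) * Real.exp (-(t * y)) := by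
    rw [integral_const_mul, integral_exp_mul_Iic (by linarith),
      show (y + c) * t = c * t + t * y by ring, Real.exp_add, Real.exp_neg]
    have := Real.exp_ne_zero (t * y)
    field_simp
  unfold edge
  rw [sub_mul, e1, sub_sub_cancel_left, norm_neg, norm_mul, Complex.norm_real,
    Real.norm_of_nonneg (Real.exp_nonneg _), e2, ← integral_Iic_eq_integral_Iio]
  refine mul_le_mul_of_nonneg_right ?_ (Real.exp_nonneg _)
  refine norm_integral_le_of_norm_le ((integrableOn_exp_mul_Iic (by linarith) t).const_mul B)
    (ae_of_all _ fun x => ?_)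
  rw [norm_mul, norm_exp_I_mul, Complex.norm_real, Real.norm_eq_abs]
  calc |φ x| * _ ≤ (B * Real.exp (c * x)) * _ := by gcongr; exact hB x
    _ = _ := by rw [mul_assoc, ← Real.exp_add]; congr 2; simp; ring

end IsBoundaryDensity

/-! ### The determinant identity -/

section Determinant

variable {K : ℝ → ℝ} {t c M : ℝ} {φ ψ : ℝ → ℝ} {Θ : ℂ → ℂ}

/-- The `Θ` terms cancel. The right side is entire, while on the left each wave decays as fast as
its partner can grow. -/
theorem wave_mul_edge_add (z : ℂ) :
    wave 1 t φ Θ z * edge t ψ (-z) + wave (-1) t ψ Θ z * edge t φ (-z) =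
      edge t φ z * edge t ψ (-z) + edge t φ (-z) * edge t ψ z := by
  unfold wave
  push_cast
  ring

/-- The determinant of the transfer matrix is constant. -/
theorem edge_mul_edge_add (hK : Continuous K) (h3 : CondK3 K)
    (hM : ∀ x, |K x| ≤ M * Real.exp (c * x)) (hφ : IsBoundaryDensity K 1 t φ)
    (hψ : IsBoundaryDensity K (-1) t ψ) (hΘ1 : ∀ z : ℂ, 0 < z.im → ‖Θ z‖ ≤ 1)
    (hΘ : ∀ z : ℂ, c < z.im → Θ z = fourierIntegral K z) (z : ℂ) :
    edge t φ z * edge t ψ (-z) + edge t φ (-z) * edge t ψ z = 2 := by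
  set D : ℂ → ℂ := fun z => edge t φ z * edge t ψ (-z) + edge t φ (-z) * edge t ψ z with hD
  have heven : ∀ z, D (-z) = D z := fun z => by
    simp only [hD, neg_neg]; ring
  have hdiff : Differentiable ℂ D := by
    have h1 := hφ.differentiable_edge
    have h2 := hψ.differentiable_edge
    exact (h1.mul (h2.comp differentiable_neg)).add ((h1.comp differentiable_neg).mul h2)
  obtain ⟨C₁, hC₁⟩ := hφ.exists_norm_wave_le hK h3 hM (by simp) hΘ1 hΘ
  obtain ⟨C₂, hC₂⟩ := hψ.exists_norm_wave_le hK h3 hM (by simp) hΘ1 hΘ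
  set I₁ := 1 + ∫ y in Iio t, |φ y| with hI₁
  set I₂ := 1 + ∫ y in Iio t, |ψ y| with hI₂
  have hI₁0 : 0 ≤ I₁ := by have := IsBoundaryDensity.integral_abs_nonneg t φ; positivity
  have hI₂0 : 0 ≤ I₂ := by have := IsBoundaryDensity.integral_abs_nonneg t ψ; positivity
  have hup : ∀ z : ℂ, 0 < z.im → ‖D z‖ ≤ C₁ * I₂ + C₂ * I₁ := fun z hz => by
    have hexp : Real.exp (-(t * z.im)) * Real.exp (t * z.im) = 1 := by
      rw [← Real.exp_add, neg_add_cancel, Real.exp_zero]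
    simp only [hD]
    rw [← wave_mul_edge_add (Θ := Θ)]
    refine (norm_add_le _ _).trans ?_
    rw [norm_mul, norm_mul]
    refine add_le_add ?_ ?_
    · refine (mul_le_mul (hC₁ z hz) (hψ.norm_edge_neg_le hz.le) (norm_nonneg _)
        ((norm_nonneg _).trans (hC₁ z hz))).trans_eq ?_
      linear_combination C₁ * I₂ * hexp
    · refine (mul_le_mul (hC₂ z hz) (hφ.norm_edge_neg_le hz.le) (norm_nonneg _)
        ((norm_nonneg _).trans (hC₂ z hz))).trans_eq ?_
      linear_combination C₂ * I₁ * hexp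
  have hreal : ∀ z : ℂ, z.im = 0 → ‖D z‖ ≤ 2 * (I₁ * I₂) := fun z hz => by
    have b1 := hφ.norm_edge_le z
    have b2 := hφ.norm_edge_le (-z)
    have b3 := hψ.norm_edge_le z
    have b4 := hψ.norm_edge_le (-z)
    simp only [Complex.neg_im, hz, neg_zero, abs_zero, mul_zero, Real.exp_zero, mul_one]
      at b1 b2 b3 b4
    refine (norm_add_le _ _).trans ?_
    rw [norm_mul, norm_mul]
    have := mul_le_mul b1 b4 (norm_nonneg _) hI₁0
    have := mul_le_mul b2 b3 (norm_nonneg _) hI₁0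
    linarith
  -- Evenness carries the bound from the upper to the lower half-plane, and Liouville's theorem
  -- applies.
  have hbdd : Bornology.IsBounded (Set.range D) := by
    rw [isBounded_iff_forall_norm_le]
    refine ⟨max (C₁ * I₂ + C₂ * I₁) (2 * (I₁ * I₂)), ?_⟩
    rintro _ ⟨z, rfl⟩
    rcases lt_trichotomy z.im 0 with hz | hz | hz
    · rw [← heven]
      exact (hup (-z) (by simpa using hz)).trans (le_max_left _ _)
    · exact (hreal z hz).trans (le_max_right _ _)
    · exact (hup z hz).trans (le_max_left _ _)
  have hconst := hdiff.apply_eq_apply_of_bounded hbdd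
  have hlim : Tendsto (fun y : ℝ => D (y * Complex.I)) atTop (𝓝 (1 * 1 + 1 * 1)) := by
    have l1 := hφ.tendsto_wave hK h3 hM (by simp) hΘ
    have l2 := hψ.tendsto_wave hK h3 hM (by simp) hΘ
    have l3 := hφ.tendsto_edge hM (by simp)
    have l4 := hψ.tendsto_edge hM (by simp)
    refine ((l1.mul l4).add (l2.mul l3)).congr fun y => ?_
    have hexp : (Real.exp (t * y) : ℂ) * Real.exp (-(t * y)) = 1 := by
      rw [← Complex.ofReal_mul, ← Real.exp_add, add_neg_cancel, Real.exp_zero, Complex.ofReal_one]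
    simp only [hD]
    rw [← wave_mul_edge_add (Θ := Θ)]
    linear_combination (wave 1 t φ Θ (y * Complex.I) * edge t ψ (-(y * Complex.I)) +
      wave (-1) t ψ Θ (y * Complex.I) * edge t φ (-(y * Complex.I))) * hexp
  have hlim2 : Tendsto (fun y : ℝ => D (y * Complex.I)) atTop (𝓝 (D z)) :=
    tendsto_const_nhds.congr fun y => hconst z _
  refine (tendsto_nhds_unique hlim2 hlim).trans ?_
  norm_num

theorem edge_zero (t : ℝ) (φ : ℝ → ℝ) :
    edge t φ 0 = (IsBoundaryDensity.leftValue t φ : ℂ) := by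
  unfold edge IsBoundaryDensity.leftValue
  simp [integral_complex_ofReal]

/-- The determinant identity at `z = 0`. It shows that both normalising constants are nonzero. -/
theorem leftValue_mul_leftValue (hK : Continuous K) (h3 : CondK3 K)
    (hM : ∀ x, |K x| ≤ M * Real.exp (c * x)) (hφ : IsBoundaryDensity K 1 t φ)
    (hψ : IsBoundaryDensity K (-1) t ψ) (hΘ1 : ∀ z : ℂ, 0 < z.im → ‖Θ z‖ ≤ 1)
    (hΘ : ∀ z : ℂ, c < z.im → Θ z = fourierIntegral K z) :
    IsBoundaryDensity.leftValue t φ * IsBoundaryDensity.leftValue t ψ = 1 := by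
  have h := edge_mul_edge_add hK h3 hM hφ hψ hΘ1 hΘ 0
  rw [neg_zero, edge_zero, edge_zero] at h
  have h2 : ((IsBoundaryDensity.leftValue t φ * IsBoundaryDensity.leftValue t ψ : ℝ) : ℂ) =
      (1 : ℝ) := by
    push_cast
    linear_combination h / 2
  exact_mod_cast h2

end Determinant

/-! ### A boundary maximum principle -/

/-- The Möbius map of the unit disc onto the upper half-plane sending `0` to `w`. -/
def discToUHP (w ζ : ℂ) : ℂ := (w - conj w * ζ) / (1 - ζ)

theorem discToUHP_eq (w ζ : ℂ) :
    discToUHP w ζ = ((w - conj w * ζ) * (1 - conj ζ)) / (Complex.normSq (1 - ζ) : ℂ) := by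
  unfold discToUHP
  rcases eq_or_ne (1 - ζ) 0 with h | h
  · simp [h]
  · have h' : 1 - conj ζ ≠ 0 := by
      intro h0
      apply h
      have := congrArg conj h0
      simpa using this
    rw [← Complex.mul_conj, map_sub, map_one, mul_div_mul_right _ _ h']

theorem discToUHP_im (w ζ : ℂ) :
    (discToUHP w ζ).im = w.im * (1 - Complex.normSq ζ) / Complex.normSq (1 - ζ) := by
  rw [discToUHP_eq, Complex.div_ofReal_im]
  congr 1
  simp [Complex.normSq_apply]
  ring

theorem discToUHP_im_pos {w ζ : ℂ} (hw : 0 < w.im) (hζ : ‖ζ‖ < 1) : 0 < (discToUHP w ζ).im := by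
  rw [discToUHP_im]
  have h1 : Complex.normSq ζ < 1 := by
    rw [Complex.normSq_eq_norm_sq]
    nlinarith [norm_nonneg ζ]
  have h2 : 0 < Complex.normSq (1 - ζ) := by
    rw [Complex.normSq_pos, sub_ne_zero]
    rintro rfl
    simp at hζ
  exact div_pos (mul_pos hw (by linarith)) h2

theorem discToUHP_im_eq_zero {w ζ : ℂ} (hζ : ‖ζ‖ = 1) : (discToUHP w ζ).im = 0 := by
  rw [discToUHP_im, Complex.normSq_eq_norm_sq ζ, hζ]
  simp

theorem differentiableAt_discToUHP (w : ℂ) {ζ : ℂ} (hζ : ζ ≠ 1) :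
    DifferentiableAt ℂ (discToUHP w) ζ := by
  unfold discToUHP
  exact DifferentiableAt.div (by fun_prop) (by fun_prop) (sub_ne_zero.2 hζ.symm)

theorem eq_of_discToUHP {w ζ : ℂ} (hw : 0 < w.im) (hζ : ζ ≠ 1) :
    ζ = (discToUHP w ζ - w) / (discToUHP w ζ - conj w) := by
  have h1 : 1 - ζ ≠ 0 := sub_ne_zero.2 hζ.symm
  have h2 : w - conj w ≠ 0 := by
    rw [Complex.sub_conj]
    simp [hw.ne']
  have e1 : discToUHP w ζ - w = (w - conj w) * ζ / (1 - ζ) := by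
    unfold discToUHP; field_simp; ring
  have e2 : discToUHP w ζ - conj w = (w - conj w) / (1 - ζ) := by
    unfold discToUHP; field_simp; ring
  rw [e1, e2]
  field_simp

/-- A bounded analytic function in the upper half-plane whose boundary values exist and are bounded
by `1` outside a countable set is bounded by `1`. -/
theorem norm_le_one_of_boundary {f : ℂ → ℂ} {C : ℝ} {S : Set ℝ}
    (hf : DifferentiableOn ℂ f {z : ℂ | 0 < z.im}) (hC : ∀ z : ℂ, 0 < z.im → ‖f z‖ ≤ C)
    (hS : S.Countable)
    (hb : ∀ x : ℝ, x ∉ S → ∃ l : ℂ, ‖l‖ ≤ 1 ∧ Tendsto f (𝓝[{z : ℂ | 0 < z.im}] (x : ℂ)) (𝓝 l))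
    {w : ℂ} (hw : 0 < w.im) : ‖f w‖ ≤ 1 := by
  set g : ℂ → ℂ := fun ζ => f (discToUHP w ζ) with hg
  have hgd : ∀ ζ : ℂ, ‖ζ‖ < 1 → DifferentiableAt ℂ g ζ := fun ζ hζ => by
    have h1 : ζ ≠ 1 := by rintro rfl; simp at hζ
    exact ((hf.differentiableAt ((isOpen_im_gt 0).mem_nhds (discToUHP_im_pos hw hζ))).comp ζ
      (differentiableAt_discToUHP w h1))
  have hg0 : g 0 = f w := by simp [hg, discToUHP]
  let r : ℕ → ℝ := fun n => 1 - 1 / ((n : ℝ) + 1)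
  have hr0 : ∀ n, 0 ≤ r n := fun n => by
    simp only [r, sub_nonneg]
    rw [div_le_one (by positivity)]; linarith [(Nat.cast_nonneg n : (0 : ℝ) ≤ n)]
  have hr1 : ∀ n, r n < 1 := fun n => by
    simp only [r]; linarith [(by positivity : (0 : ℝ) < 1 / ((n : ℝ) + 1))]
  have hrlim : Tendsto r atTop (𝓝 1) := by
    have := tendsto_one_div_add_atTop_nhds_zero_nat (𝕜 := ℝ)
    simpa [r] using this.const_sub 1
  have hcirc : ∀ n θ, ‖circleMap 0 (r n) θ‖ < 1 := fun n θ => by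
    rw [norm_circleMap_zero, abs_of_nonneg (hr0 n)]; exact hr1 n
  -- Mean value property in the disc. Replacing the modulus by its maximum with `1` gives an
  -- integrand that converges to exactly `1`, so convergence of the boundary values themselves is
  -- not needed in the integral.
  have hmean : ∀ n, ‖f w‖ ≤ (2 * Real.pi)⁻¹ *
      ∫ θ in (0 : ℝ)..2 * Real.pi, max ‖g (circleMap 0 (r n) θ)‖ 1 := fun n => by
    have h1 : DifferentiableOn ℂ g (Metric.closedBall 0 |r n|) := fun ζ hζ => by
      refine (hgd ζ ?_).differentiableWithinAt
      rw [mem_closedBall_zero_iff, abs_of_nonneg (hr0 n)] at hζ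
      exact hζ.trans_lt (hr1 n)
    have h2 := circleAverage_of_differentiable_on_off_countable (f := g) (c := 0) (R := r n)
      countable_empty h1.continuousOn (fun z hz => hgd z (by
        have := hz.1
        rw [mem_ball_zero_iff, abs_of_nonneg (hr0 n)] at this
        exact this.trans (hr1 n)))
    rw [← hg0, ← h2, Real.circleAverage_def, norm_smul, Real.norm_of_nonneg (by positivity)]
    have hcont : Continuous fun θ => g (circleMap 0 (r n) θ) :=
      continuous_iff_continuousAt.2 fun θ =>
        ContinuousAt.comp (g := g) (hgd _ (hcirc n θ)).continuousAt (continuous_circleMap 0 (r n)).continuousAt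
    gcongr
    refine (intervalIntegral.norm_integral_le_integral_norm Real.two_pi_pos.le).trans ?_
    exact intervalIntegral.integral_mono_on Real.two_pi_pos.le
      (hcont.norm.intervalIntegrable _ _) ((hcont.norm.max continuous_const).intervalIntegrable _ _)
      fun θ _ => le_max_left _ _
  -- The exceptional points on the circle: `1`, which corresponds to infinity, and the points that
  -- map into `S`.
  set T : Set ℂ := insert 1 ((fun x : ℝ => ((x : ℂ) - w) / ((x : ℂ) - conj w)) '' S) with hT
  have hTc : T.Countable := (hS.image _).insert 1
  have hpt : ∀ θ : ℝ, circleMap 0 1 θ ∉ T →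
      Tendsto (fun n => max ‖g (circleMap 0 (r n) θ)‖ 1) atTop (𝓝 1) := fun θ hθ => by
    set ζ := circleMap 0 1 θ with hζ
    have hζ1 : ζ ≠ 1 := fun h => hθ (h ▸ mem_insert _ _)
    have hnorm : ‖ζ‖ = 1 := by rw [hζ, norm_circleMap_zero, abs_one]
    set x : ℝ := (discToUHP w ζ).re with hx
    have hxe : discToUHP w ζ = (x : ℂ) := Complex.ext (by simp [hx])
      (by simpa using discToUHP_im_eq_zero hnorm)
    have hxS : x ∉ S := fun h => hθ (mem_insert_of_mem _ ⟨x, h, by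
      simp only
      rw [← hxe]; exact (eq_of_discToUHP hw hζ1).symm⟩)
    obtain ⟨l, hl, hlim⟩ := hb x hxS
    have h1 : Tendsto (fun n => circleMap 0 (r n) θ) atTop (𝓝 ζ) := by
      simp only [circleMap, zero_add, hζ]
      refine Tendsto.mul_const _ ?_
      exact (Complex.continuous_ofReal.tendsto _).comp hrlim
    have h2 : Tendsto (fun n => discToUHP w (circleMap 0 (r n) θ)) atTop
        (𝓝[{z : ℂ | 0 < z.im}] (x : ℂ)) := by
      rw [← hxe]
      exact tendsto_nhdsWithin_iff.2
        ⟨(differentiableAt_discToUHP w hζ1).continuousAt.tendsto.comp h1,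
          Eventually.of_forall fun n => discToUHP_im_pos hw (hcirc n θ)⟩
    have h3 := ((hlim.comp h2).norm).max (tendsto_const_nhds (x := (1 : ℝ)))
    rwa [max_eq_right hl] at h3
  have hDCT : Tendsto (fun n => ∫ θ in (0 : ℝ)..2 * Real.pi, max ‖g (circleMap 0 (r n) θ)‖ 1) atTop
      (𝓝 (∫ θ in (0 : ℝ)..2 * Real.pi, (1 : ℝ))) := by
    refine intervalIntegral.tendsto_integral_filter_of_dominated_convergence (fun _ => max C 1)
      (Eventually.of_forall fun n => ?_) (Eventually.of_forall fun n => ae_of_all _ fun θ _ => ?_)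
      intervalIntegrable_const ?_
    · refine (Continuous.max (Continuous.norm ?_) continuous_const).aestronglyMeasurable
      exact continuous_iff_continuousAt.2 fun θ =>
        ContinuousAt.comp (g := g) (hgd _ (hcirc n θ)).continuousAt (continuous_circleMap 0 (r n)).continuousAt
    · rw [Real.norm_of_nonneg (le_max_of_le_right zero_le_one)]
      exact max_le_max (hC _ (discToUHP_im_pos hw (hcirc n θ))) le_rfl
    · have hc : (circleMap 0 1 ⁻¹' T).Countable := hTc.preimage_circleMap 0 one_ne_zero
      filter_upwards [hc.ae_notMem volume] with θ hθ _
      exact hpt θ hθ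
  have hfin := ge_of_tendsto (hDCT.const_mul (2 * Real.pi)⁻¹) (Eventually.of_forall hmean)
  rw [intervalIntegral.integral_const, sub_zero, smul_eq_mul, mul_one,
    inv_mul_cancel₀ Real.two_pi_pos.ne'] at hfin
  exact hfin

/-- A bounded analytic function in the upper half-plane with boundary values of nonnegative real
part outside a countable set has nonnegative real part. -/
theorem re_nonneg_of_boundary {U : ℂ → ℂ} {C : ℝ} {S : Set ℝ}
    (hU : DifferentiableOn ℂ U {z : ℂ | 0 < z.im}) (hC : ∀ z : ℂ, 0 < z.im → ‖U z‖ ≤ C)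
    (hS : S.Countable)
    (hb : ∀ x : ℝ, x ∉ S → ∃ l : ℂ, 0 ≤ l.re ∧ Tendsto U (𝓝[{z : ℂ | 0 < z.im}] (x : ℂ)) (𝓝 l))
    {w : ℂ} (hw : 0 < w.im) : 0 ≤ (U w).re := by
  -- `exp(-U)` has modulus at most `1` exactly where `U` has nonnegative real part.
  have h := norm_le_one_of_boundary (f := fun z => Complex.exp (-U z)) (C := Real.exp C) (S := S)
    hU.neg.cexp (fun z hz => ?_) hS (fun x hx => ?_) hw
  · rw [Complex.norm_exp, Real.exp_le_one_iff] at h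
    simpa using h
  · rw [Complex.norm_exp, Real.exp_le_exp]
    refine (Complex.re_le_norm _).trans ?_
    rw [norm_neg]; exact hC z hz
  · obtain ⟨l, hl, hlim⟩ := hb x hx
    refine ⟨Complex.exp (-l), ?_, (Complex.continuous_exp.tendsto _).comp hlim.neg⟩
    rw [Complex.norm_exp, Real.exp_le_one_iff]
    simpa using hl

/-! ### Positivity of the pair of waves -/

section Positivity

variable {Θ q₁ q₂ : ℂ → ℂ} {t C : ℝ} {S : Set ℝ}

/-- For a Schur function `Θ` with unimodular boundary values and a transfer matrix of determinant
one, the two boundary waves have a quotient of nonnegative real part. -/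
theorem re_mul_conj_nonneg (hΘ : DifferentiableOn ℂ Θ {z : ℂ | 0 < z.im})
    (hq₁ : Differentiable ℂ q₁) (hq₂ : Differentiable ℂ q₂)
    (hs₁ : ∀ z, conj (q₁ (conj z)) = q₁ (-z)) (hs₂ : ∀ z, conj (q₂ (conj z)) = q₂ (-z))
    (hb₁ : ∀ z : ℂ, 0 < z.im → ‖q₁ (-z)‖ ≤ C * Real.exp (t * z.im))
    (hb₂ : ∀ z : ℂ, 0 < z.im → ‖q₂ (-z)‖ ≤ C * Real.exp (t * z.im))
    (hm : ∀ z : ℂ, 0 < z.im → ‖q₁ z - Θ z * q₁ (-z)‖ ≤ C * Real.exp (-(t * z.im)))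
    (hp : ∀ z : ℂ, 0 < z.im → ‖q₂ z + Θ z * q₂ (-z)‖ ≤ C * Real.exp (-(t * z.im)))
    (hdet : ∀ z, q₁ z * q₂ (-z) + q₁ (-z) * q₂ z = 2) (hS : S.Countable)
    (hbd : ∀ x : ℝ, x ∉ S → ∃ u : ℂ, ‖u‖ = 1 ∧
      Tendsto Θ (𝓝[{z : ℂ | 0 < z.im}] (x : ℂ)) (𝓝 u)) {w : ℂ} (hw : 0 < w.im) :
    0 ≤ ((q₂ w + Θ w * q₂ (-w)) * conj (q₁ w - Θ w * q₁ (-w))).re := by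
  set p : ℂ → ℂ := fun z => q₂ z + Θ z * q₂ (-z) with hpdef
  set m : ℂ → ℂ := fun z => q₁ z - Θ z * q₁ (-z) with hmdef
  set a := p w with ha
  set b := m w with hbw
  -- With `a = p(w)` and `b = m(w)` frozen, `U` is a combination of products of one wave with one
  -- `qᵢ(-z)`, hence analytic and bounded because the exponentials cancel. The coefficients are
  -- chosen so that `Re U` is a square `|N|²` at the boundary, while `U(w) = Re (a b̄)` by the
  -- determinant identity.
  let V : ℂ → ℂ → ℂ → ℂ → ℂ := fun P M Q₁ Q₂ =>
    1 / 2 * (a * conj a) * (M * Q₁) + 1 / 2 * (b * conj b) * (P * Q₂) +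
      1 / 4 * (conj a * b - a * conj b) * (M * Q₂ - P * Q₁)
  set U : ℂ → ℂ := fun z => V (p z) (m z) (q₁ (-z)) (q₂ (-z)) with hU
  have hn₁ : Differentiable ℂ fun z => q₁ (-z) := hq₁.comp differentiable_neg
  have hn₂ : Differentiable ℂ fun z => q₂ (-z) := hq₂.comp differentiable_neg
  have hpd : DifferentiableOn ℂ p {z : ℂ | 0 < z.im} :=
    hq₂.differentiableOn.add (hΘ.mul hn₂.differentiableOn)
  have hmd : DifferentiableOn ℂ m {z : ℂ | 0 < z.im} :=
    hq₁.differentiableOn.sub (hΘ.mul hn₁.differentiableOn)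
  have hUd : DifferentiableOn ℂ U {z : ℂ | 0 < z.im} := by
    have d1 := hn₁.differentiableOn (s := {z : ℂ | 0 < z.im})
    have d2 := hn₂.differentiableOn (s := {z : ℂ | 0 < z.im})
    exact (((hmd.mul d1).const_mul _).add ((hpd.mul d2).const_mul _)).add
      (((hmd.mul d2).sub (hpd.mul d1)).const_mul _)
  have hprod : ∀ {f g : ℂ → ℂ} {z : ℂ}, ‖f z‖ ≤ C * Real.exp (-(t * z.im)) →
      ‖g (-z)‖ ≤ C * Real.exp (t * z.im) → ‖f z * g (-z)‖ ≤ C * C := by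
    intro f g z h1 h2
    rw [norm_mul]
    refine (mul_le_mul h1 h2 (norm_nonneg _) ((norm_nonneg _).trans h1)).trans_eq ?_
    have : Real.exp (-(t * z.im)) * Real.exp (t * z.im) = 1 := by
      rw [← Real.exp_add, neg_add_cancel, Real.exp_zero]
    linear_combination C * C * this
  have hUb : ∀ z : ℂ, 0 < z.im → ‖U z‖ ≤ ‖1 / 2 * (a * conj a)‖ * (C * C) +
      ‖1 / 2 * (b * conj b)‖ * (C * C) +
      ‖1 / 4 * (conj a * b - a * conj b)‖ * (C * C + C * C) := fun z hz => by
    refine (norm_add_le _ _).trans (add_le_add ((norm_add_le _ _).trans (add_le_add ?_ ?_)) ?_)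
    · rw [norm_mul]
      exact mul_le_mul_of_nonneg_left (hprod (hm z hz) (hb₁ z hz)) (norm_nonneg _)
    · rw [norm_mul]
      exact mul_le_mul_of_nonneg_left (hprod (hp z hz) (hb₂ z hz)) (norm_nonneg _)
    · rw [norm_mul]
      refine mul_le_mul_of_nonneg_left ((norm_sub_le _ _).trans (add_le_add ?_ ?_)) (norm_nonneg _)
      · exact hprod (hm z hz) (hb₂ z hz)
      · exact hprod (hp z hz) (hb₁ z hz)
  have hbound : ∀ x : ℝ, x ∉ S → ∃ l : ℂ, 0 ≤ l.re ∧
      Tendsto U (𝓝[{z : ℂ | 0 < z.im}] (x : ℂ)) (𝓝 l) := fun x hx => by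
    obtain ⟨u, hu, hlim⟩ := hbd x hx
    have l1 := hq₁.continuous.continuousWithinAt (s := {z : ℂ | 0 < z.im}) (x := (x : ℂ))
    have l2 := hq₂.continuous.continuousWithinAt (s := {z : ℂ | 0 < z.im}) (x := (x : ℂ))
    have l3 := hn₁.continuous.continuousWithinAt (s := {z : ℂ | 0 < z.im}) (x := (x : ℂ))
    have l4 := hn₂.continuous.continuousWithinAt (s := {z : ℂ | 0 < z.im}) (x := (x : ℂ))
    have lp := Tendsto.add l2 (hlim.mul l4)
    have lm := Tendsto.sub l1 (hlim.mul l3)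
    refine ⟨V (q₂ x + u * q₂ (-x)) (q₁ x - u * q₁ (-x)) (q₁ (-x)) (q₂ (-x)), ?_,
      (((lm.mul l3).const_mul _).add ((lp.mul l4).const_mul _)).add
      (((lm.mul l4).sub (lp.mul l3)).const_mul _)⟩
    set N := 1 / 2 * (conj a * (q₁ x - u * q₁ (-x)) + conj b * (q₂ x + u * q₂ (-x))) with hN
    have huu : u * conj u = 1 := by
      rw [Complex.mul_conj, Complex.normSq_eq_norm_sq, hu]; simp
    have c1 : conj (q₁ x) = q₁ (-x) := by simpa using hs₁ x
    have c2 : conj (q₂ x) = q₂ (-x) := by simpa using hs₂ x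
    have c3 : conj (q₁ (-x)) = q₁ x := by rw [← c1, Complex.conj_conj]
    have c4 : conj (q₂ (-x)) = q₂ x := by rw [← c2, Complex.conj_conj]
    have key : V (q₂ x + u * q₂ (-x)) (q₁ x - u * q₁ (-x)) (q₁ (-x)) (q₂ (-x)) +
        conj (V (q₂ x + u * q₂ (-x)) (q₁ x - u * q₁ (-x)) (q₁ (-x)) (q₂ (-x))) =
        2 * (N * conj N) := by
      simp only [V, hN, map_add, map_sub, map_mul, c1, c2, c3, c4, Complex.conj_conj, map_div₀,
        map_one, map_ofNat]
      -- The boundary identity uses unimodularity of `u` and the symmetry that conjugation swaps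
      -- `qᵢ(x)` and `qᵢ(-x)`.
      linear_combination (-1 / 2 * (conj b * q₂ (-x) - conj a * q₁ (-x)) *
        (b * q₂ x - a * q₁ x)) * huu
    rw [Complex.mul_conj, Complex.add_conj] at key
    have : 2 * (V (q₂ x + u * q₂ (-x)) (q₁ x - u * q₁ (-x)) (q₁ (-x)) (q₂ (-x))).re =
        2 * Complex.normSq N := by exact_mod_cast key
    linarith [Complex.normSq_nonneg N]
  have hfin := re_nonneg_of_boundary hUd hUb hS hbound hw
  have hUw : U w = 1 / 2 * (conj a * b + conj b * a) := by
    have h1 : a * q₁ (-w) + b * q₂ (-w) = 2 := by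
      rw [ha, hbw, hpdef, hmdef]
      linear_combination hdet w
    simp only [hU, V, ← ha, ← hbw]
    linear_combination 1 / 4 * (conj a * b + conj b * a) * h1
  rw [hUw] at hfin
  have e : (1 / 2 * (conj a * b + conj b * a) : ℂ) = ((a * conj b).re : ℂ) := by
    rw [Complex.re_eq_add_conj]
    simp only [map_mul, Complex.conj_conj]; ring
  rwa [e, Complex.ofReal_re] at hfin

end Positivity

/-! ### Half-line transforms of the primitives -/

namespace IsBoundaryDensity

variable {K : ℝ → ℝ} {σ t c B : ℝ} {φ : ℝ → ℝ}

theorem abs_primitive_le (hc : 0 < c)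
    (hB : ∀ x, |φ x| ≤ B * Real.exp (c * x)) {x : ℝ} (hx : t ≤ x) :
    |primitive t φ x| ≤ (Real.exp (-(c * t)) + B / c) * Real.exp (c * x) := by
  have hB0 : 0 ≤ B := by
    have := (abs_nonneg _).trans (hB 0)
    simpa using this
  have h1 : |∫ s in t..x, φ s| ≤ ∫ s in t..x, B * Real.exp (c * s) := by
    have hcont : Continuous fun s => B * Real.exp (c * s) := by fun_prop
    rw [← Real.norm_eq_abs]
    exact intervalIntegral.norm_integral_le_of_norm_le hx
      (ae_of_all _ fun s _ => (Real.norm_eq_abs _).trans_le (hB s))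
      (hcont.intervalIntegrable _ _)
  have h2 : ∫ s in t..x, B * Real.exp (c * s) = B / c * (Real.exp (c * x) - Real.exp (c * t)) := by
    rw [intervalIntegral.integral_const_mul,
      intervalIntegral.integral_comp_mul_left (fun s => Real.exp s) hc.ne', integral_exp,
      smul_eq_mul]
    ring
  have h3 : 1 ≤ Real.exp (-(c * t)) * Real.exp (c * x) := by
    rw [← Real.exp_add]
    apply Real.one_le_exp
    nlinarith
  have h4 : 0 ≤ B / c * Real.exp (c * t) := by positivity
  unfold primitive
  refine (abs_add_le _ _).trans ?_
  rw [abs_one]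
  linarith

theorem integrableOn_primitive (hc : 0 < c) (h : IsBoundaryDensity K σ t φ)
    (hB : ∀ x, |φ x| ≤ B * Real.exp (c * x)) {z : ℂ} (hz : c < z.im) :
    IntegrableOn (fun x : ℝ => (primitive t φ x : ℂ) * Complex.exp (Complex.I * z * x))
      (Ioi t) := by
  refine Integrable.mono' (((integrableOn_exp_mul_Ioi (a := c - z.im) (by linarith) t)).const_mul
    (Real.exp (-(c * t)) + B / c))
    ((Complex.continuous_ofReal.comp h.continuous_primitive).mul
      (continuous_exp_I_mul z)).aestronglyMeasurable
    ((ae_restrict_iff' measurableSet_Ioi).2 (ae_of_all _ fun x hx => ?_))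
  rw [norm_mul, norm_exp_I_mul, Complex.norm_real, Real.norm_eq_abs]
  calc _ ≤ ((Real.exp (-(c * t)) + B / c) * Real.exp (c * x)) * Real.exp (-(z.im * x)) := by
        gcongr; exact abs_primitive_le hc hB (mem_Ioi.1 hx).le
    _ = _ := by rw [mul_assoc, ← Real.exp_add]; congr 2; ring

/-- Integration by parts. The boundary term comes from the normalisation at `t`; the one at infinity
vanishes because the exponential beats the growth `e^{cx}`. -/
theorem integral_primitive (hc : 0 < c) (h : IsBoundaryDensity K σ t φ)
    (hB : ∀ x, |φ x| ≤ B * Real.exp (c * x)) {z : ℂ} (hz : c < z.im) :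
    -(Complex.I * z) * ∫ x in Ioi t, (primitive t φ x : ℂ) * Complex.exp (Complex.I * z * x) =
      Complex.exp (Complex.I * z * t) +
        ∫ x in Ioi t, (φ x : ℂ) * Complex.exp (Complex.I * z * x) := by
  have hI := h.integrableOn_primitive hc hB hz
  have h1 : ∀ x : ℝ, (primitive t φ x : ℂ) * (Complex.I * z * Complex.exp (Complex.I * z * x)) =
      (Complex.I * z) * ((primitive t φ x : ℂ) * Complex.exp (Complex.I * z * x)) := fun x => by
    ring
  have key := integral_Ioi_mul_deriv_eq_deriv_mul (a := t)
    (u := fun x : ℝ => (primitive t φ x : ℂ)) (u' := fun x : ℝ => (φ x : ℂ))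
    (v := fun x : ℝ => Complex.exp (Complex.I * z * x))
    (v' := fun x : ℝ => Complex.I * z * Complex.exp (Complex.I * z * x))
    (a' := Complex.exp (Complex.I * z * t)) (b' := 0)
    (fun x _ => (h.hasDerivAt_primitive x).ofReal_comp)
    (fun x _ => by
      have := ((hasDerivAt_id (x : ℂ)).const_mul (Complex.I * z)).cexp.comp_ofReal
      exact this.congr_deriv (by simp only [id]; ring)) ?_ ?_ ?_ ?_
  · simp_rw [h1] at key
    rw [integral_const_mul] at key
    linear_combination -key
  · refine (hI.const_mul (Complex.I * z)).congr (ae_of_all _ fun x => ?_)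
    simp only [Pi.mul_apply]; ring
  · exact (h.integrable_transform hB hz).integrableOn
  · have hcont : Continuous ((fun x : ℝ => (primitive t φ x : ℂ)) *
        fun x : ℝ => Complex.exp (Complex.I * z * x)) :=
      (Complex.continuous_ofReal.comp h.continuous_primitive).mul (continuous_exp_I_mul z)
    have := (hcont.tendsto t).mono_left (nhdsWithin_le_nhds (s := Ioi t))
    simpa [primitive] using this
  · rw [tendsto_zero_iff_norm_tendsto_zero]
    have hlim : Tendsto (fun x : ℝ => (Real.exp (-(c * t)) + B / c) * Real.exp ((c - z.im) * x))
        atTop (𝓝 ((Real.exp (-(c * t)) + B / c) * 0)) :=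
      (Real.tendsto_exp_atBot.comp (tendsto_id.const_mul_atTop_of_neg (by linarith))).const_mul _
    rw [mul_zero] at hlim
    refine squeeze_zero' (Eventually.of_forall fun _ => norm_nonneg _) ?_ hlim
    filter_upwards [eventually_ge_atTop t] with x hx
    simp only [Pi.mul_apply]
    rw [norm_mul, norm_exp_I_mul, Complex.norm_real, Real.norm_eq_abs]
    calc _ ≤ ((Real.exp (-(c * t)) + B / c) * Real.exp (c * x)) * Real.exp (-(z.im * x)) := by
          gcongr; exact abs_primitive_le hc hB hx
      _ = _ := by rw [mul_assoc, ← Real.exp_add]; congr 2; ring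

end IsBoundaryDensity

/-! ### The identity theorem off the singular set -/

section Domain

variable {E Θ : ℂ → ℂ} {c : ℝ} {Z : Set ℂ}

theorem CondK1.countable (h1 : CondK1 E c Z) : Z.Countable :=
  (HereditarilyLindelofSpace.isLindelof Z).countable_of_isDiscrete h1.isDiscrete

theorem CondK1.isPreconnected_compl (h1 : CondK1 E c Z) : IsPreconnected Zᶜ :=
  (h1.countable.isConnected_compl_of_one_lt_rank (by simp)).isPreconnected

theorem CondK1.notMem_of_lt (h1 : CondK1 E c Z) {z : ℂ} (hz : c < z.im) : z ∉ Z := fun h =>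
  absurd (h1.strip z h).2 (not_le.2 hz)

theorem CondK1.neg_notMem (h1 : CondK1 E c Z) {z : ℂ} (hz : z ∉ Z) : -z ∉ Z := fun h =>
  hz (by simpa using h1.neg_mem _ h)

theorem CondK1.conj_notMem (h1 : CondK1 E c Z) {z : ℂ} (hz : z ∉ Z) : conj z ∉ Z := fun h =>
  hz (by simpa using h1.conj_mem _ h)

theorem CondK1.analytic_neg (h1 : CondK1 E c Z) : AnalyticOnNhd ℂ (fun z => E (-z)) Zᶜ :=
  fun z hz => (h1.analytic (-z) (h1.neg_notMem hz)).comp (f := fun z => -z) analyticAt_id.neg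

/-- The upper half-plane stays connected when a countable set is removed. -/
theorem isPreconnected_uhp_diff (hZ : Z.Countable) :
    IsPreconnected ({z : ℂ | 0 < z.im} ∩ Zᶜ) := by
  -- A continuous injection of the plane onto the upper half-plane; it reduces the claim to the
  -- whole plane minus a countable set.
  set e : ℂ → ℂ := fun z => z.re + Real.exp z.im * Complex.I with he
  have hre : ∀ z, (e z).re = z.re := fun z => by simp [he]
  have him : ∀ z, (e z).im = Real.exp z.im := fun z => by
    simp [he, Complex.exp_ofReal_re]
  have hinj : Function.Injective e := fun z w hzw => Complex.ext
    (by rw [← hre, hzw, hre]) (Real.exp_injective (by rw [← him, hzw, him]))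
  have hcont : Continuous e := by fun_prop
  have hpre : (e ⁻¹' Z).Countable := hZ.preimage hinj
  have himg : e '' (e ⁻¹' Z)ᶜ = {z : ℂ | 0 < z.im} ∩ Zᶜ := by
    ext z
    constructor
    · rintro ⟨w, hw, rfl⟩
      exact ⟨by rw [mem_ofPred_eq, him]; exact Real.exp_pos _, hw⟩
    · rintro ⟨hz, hzZ⟩
      have : e (z.re + Real.log z.im * Complex.I) = z := Complex.ext (by rw [hre]; simp)
        (by rw [him]; simp [Real.exp_log hz])
      exact ⟨_, by rw [mem_compl_iff, mem_preimage, this]; exact hzZ, this⟩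
  rw [← himg]
  exact (hpre.isConnected_compl_of_one_lt_rank (by simp)).isPreconnected.image e hcont.continuousOn

theorem countable_zeros (h1 : CondK1 E c Z) (hne : ∃ z, z ∉ Z ∧ E z ≠ 0) :
    {z | z ∉ Z ∧ E z = 0}.Countable := by
  refine (HereditarilyLindelofSpace.isLindelof _).countable_of_isDiscrete ?_
  rw [← codiscreteWithin_eq_bot_iff]
  rcases h1.analytic.eqOn_zero_or_eventually_ne_zero_of_preconnected h1.isPreconnected_compl
    with h | h
  · obtain ⟨z, hz, hEz⟩ := hne
    exact absurd (h hz) hEz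
  · have h2 := Filter.codiscreteWithin_mono
      (show {z | z ∉ Z ∧ E z = 0} ⊆ Zᶜ from fun z hz => hz.1) h
    rw [← empty_mem_iff_bot]
    filter_upwards [h2, self_mem_codiscreteWithin _] with z hz hz'
    exact hz hz'.2

theorem exists_ne_zero_above (h1 : CondK1 E c Z) (hne : ∃ z, z ∉ Z ∧ E z ≠ 0) :
    ∃ z : ℂ, c < z.im ∧ E z ≠ 0 := by
  by_contra! hcon
  obtain ⟨z, hz, hEz⟩ := hne
  have hmem : Complex.I * ((c + 1 : ℝ) : ℂ) ∈ {z : ℂ | c < z.im} := by simp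
  refine hEz (h1.analytic.eqOn_of_preconnected_of_eventuallyEq (g := fun _ => 0)
    (fun _ _ => analyticAt_const) h1.isPreconnected_compl
    (z₀ := Complex.I * ((c + 1 : ℝ) : ℂ)) (h1.notMem_of_lt hmem) ?_ hz)
  filter_upwards [(isOpen_im_gt c).mem_nhds hmem] with w hw
  exact hcon w hw

/-- High up this is (K2) combined with (K1); it propagates because the half-plane stays connected
off `Z`. -/
theorem mul_schur_eq {K : ℝ → ℝ} (h1 : CondK1 E c Z) (h2 : CondK2 E c Z K)
    (hΘd : DifferentiableOn ℂ Θ {z : ℂ | 0 < z.im})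
    (hΘ : ∀ z : ℂ, c < z.im → Θ z = fourierIntegral K z) {z : ℂ} (hz : 0 < z.im) (hzZ : z ∉ Z) :
    E z * Θ z = E (-z) := by
  obtain ⟨z₀, hz₀, hE₀⟩ := exists_ne_zero_above h1 h2.ne_zero
  have hz₀' : 0 < z₀.im := h1.c_pos.trans hz₀
  refine AnalyticOnNhd.eqOn_of_preconnected_of_eventuallyEq (f := fun z => E z * Θ z)
    (g := fun z => E (-z)) (U := {z : ℂ | 0 < z.im} ∩ Zᶜ)
    (fun w hw => (h1.analytic w hw.2).mul (hΘd.analyticOnNhd (isOpen_im_gt 0) w hw.1))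
    (fun w hw => h1.analytic_neg w hw.2) (isPreconnected_uhp_diff h1.countable)
    (z₀ := z₀) ⟨hz₀', h1.notMem_of_lt hz₀⟩ ?_ ⟨hz, hzZ⟩
  filter_upwards [(isOpen_im_gt c).mem_nhds hz₀,
    (h1.analytic z₀ (h1.notMem_of_lt hz₀)).continuousAt.eventually_ne hE₀] with w hw hEw
  rw [hΘ w hw, ← h2.quotient_eq w hw hEw, h1.sharp_eq w (h1.notMem_of_lt hw),
    mul_div_cancel₀ _ hEw]

theorem conj_apply_real (h1 : CondK1 E c Z) {x : ℝ} (hx : (x : ℂ) ∉ Z) :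
    conj (E x) = E (-x) := by
  have := h1.sharp_eq x hx
  simpa [sharp] using this

/-- The limit is `E(-x)/E(x)`, and (K1) makes the numerator the conjugate of the denominator. -/
theorem tendsto_schur {K : ℝ → ℝ} (h1 : CondK1 E c Z) (h2 : CondK2 E c Z K)
    (hΘd : DifferentiableOn ℂ Θ {z : ℂ | 0 < z.im})
    (hΘ : ∀ z : ℂ, c < z.im → Θ z = fourierIntegral K z) {x : ℝ} (hx : (x : ℂ) ∉ Z)
    (hE : E x ≠ 0) :
    ∃ u : ℂ, ‖u‖ = 1 ∧ Tendsto Θ (𝓝[{z : ℂ | 0 < z.im}] (x : ℂ)) (𝓝 u) := by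
  refine ⟨E (-x) / E x, ?_, ?_⟩
  · rw [← conj_apply_real h1 hx, norm_div, RCLike.norm_conj, div_self (norm_ne_zero_iff.2 hE)]
  · have hc1 := (h1.analytic x hx).continuousAt
    have hc2 := (h1.analytic_neg x hx).continuousAt
    refine Tendsto.congr' ?_ ((hc2.tendsto.div hc1.tendsto hE).mono_left nhdsWithin_le_nhds)
    filter_upwards [self_mem_nhdsWithin, mem_nhdsWithin_of_mem_nhds (hc1.eventually_ne hE),
      mem_nhdsWithin_of_mem_nhds (h1.isClosed.isOpen_compl.mem_nhds hx)] with z hz hEz hzZ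
    rw [Pi.div_apply, ← mul_schur_eq h1 h2 hΘd hΘ hz hzZ, mul_div_cancel_left₀ _ hEz]

end Domain

/-! ### The inner quotient -/

section Final

variable {E Θ : ℂ → ℂ} {c t : ℝ} {Z : Set ℂ} {K : ℝ → ℝ}

/-- The continuation of the half-line transform. -/
def continuation (E : ℂ → ℂ) (σ t : ℝ) (φ : ℝ → ℝ) (z : ℂ) : ℂ :=
  (E z * edge t φ z - σ * E (-z) * edge t φ (-z)) / (2 * IsBoundaryDensity.leftValue t φ)

theorem analytic_continuation {σ : ℝ} {φ : ℝ → ℝ} (h1 : CondK1 E c Z)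
    (hφ : IsBoundaryDensity K σ t φ) : AnalyticOnNhd ℂ (continuation E σ t φ) Zᶜ := by
  intro z hz
  have hq : AnalyticAt ℂ (edge t φ) z := hφ.differentiable_edge.analyticAt z
  have hq' : AnalyticAt ℂ (fun z => edge t φ (-z)) z :=
    (hφ.differentiable_edge.comp differentiable_neg).analyticAt z
  exact (((h1.analytic z hz).mul hq).sub
    ((analyticAt_const.mul (h1.analytic_neg z hz)).mul hq')).div_const

theorem continuation_eq_wave {σ : ℝ} {φ : ℝ → ℝ} (h1 : CondK1 E c Z) (h2 : CondK2 E c Z K)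
    (hΘd : DifferentiableOn ℂ Θ {z : ℂ | 0 < z.im})
    (hΘ : ∀ z : ℂ, c < z.im → Θ z = fourierIntegral K z) {z : ℂ} (hz : 0 < z.im) (hzZ : z ∉ Z) :
    continuation E σ t φ z =
      E z / 2 * (wave σ t φ Θ z / IsBoundaryDensity.leftValue t φ) := by
  unfold continuation wave
  rw [← mul_schur_eq h1 h2 hΘd hΘ hz hzZ]
  ring

theorem continuation_eq_halfLineTransform {σ M B : ℝ} {φ : ℝ → ℝ} (h1 : CondK1 E c Z)
    (h2 : CondK2 E c Z K) (h3 : CondK3 K) (hM : ∀ x, |K x| ≤ M * Real.exp (c * x))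
    (hΘd : DifferentiableOn ℂ Θ {z : ℂ | 0 < z.im})
    (hΘ : ∀ z : ℂ, c < z.im → Θ z = fourierIntegral K z)
    (hφ : IsBoundaryDensity K σ t φ) (hB : ∀ x, |φ x| ≤ B * Real.exp (c * x))
    {z : ℂ} (hz : c < z.im) :
    continuation E σ t φ z = halfLineTransform E t
      (fun x => ((IsBoundaryDensity.primitive t φ x / IsBoundaryDensity.leftValue t φ : ℝ) : ℂ))
      z := by
  have hz0 : 0 < z.im := h1.c_pos.trans hz
  rw [continuation_eq_wave h1 h2 hΘd hΘ hz0 (h1.notMem_of_lt hz),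
    hφ.wave_eq h2.continuous h3 hM hB hΘ hz, ← hφ.integral_primitive h1.c_pos hB hz,
    halfLineTransform]
  have e : ∀ x : ℝ, ((IsBoundaryDensity.primitive t φ x / IsBoundaryDensity.leftValue t φ : ℝ) : ℂ) *
      Complex.exp (Complex.I * z * x) = ((IsBoundaryDensity.primitive t φ x : ℝ) : ℂ) *
      Complex.exp (Complex.I * z * x) / (IsBoundaryDensity.leftValue t φ : ℂ) := fun x => by
    push_cast; ring
  simp_rw [e]
  rw [integral_div]
  ring

/-- The two signs behave oppositely: `♯` fixes the continuation for `σ = -1` and negates the one for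
`σ = 1`, so it turns their sum into a difference. -/
theorem sharp_continuation {σ : ℝ} {φ : ℝ → ℝ} (hσ : σ * σ = 1) (h1 : CondK1 E c Z) {z : ℂ}
    (hz : z ∉ Z) : conj (continuation E σ t φ (conj z)) = -σ * continuation E σ t φ z := by
  have e1 : conj (E (conj z)) = E (-z) := h1.sharp_eq z hz
  have e2 : conj (E (-conj z)) = E z := by
    have := h1.sharp_eq (-z) (h1.neg_notMem hz)
    simpa [sharp] using this
  have e3 : conj (edge t φ (-conj z)) = edge t φ z := by
    have := conj_edge t φ (-z)
    simpa using this
  have hσ' : (σ : ℂ) * σ = 1 := by exact_mod_cast hσ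
  unfold continuation
  rw [map_div₀, map_sub, map_mul, map_mul, map_mul, e1, e2, e3, conj_edge]
  simp only [map_mul, map_ofNat, Complex.conj_ofReal]
  linear_combination (-E (-z) * edge t φ (-z) / (2 * IsBoundaryDensity.leftValue t φ)) * hσ'

theorem norm_sub_le_norm_add_of_re_nonneg {p m : ℂ} (h : 0 ≤ (p * conj m).re) :
    ‖p - m‖ ≤ ‖p + m‖ := by
  refine le_of_sq_le_sq ?_ (norm_nonneg _)
  rw [← Complex.normSq_eq_norm_sq, ← Complex.normSq_eq_norm_sq, Complex.normSq_sub,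
    Complex.normSq_add]
  linarith

theorem add_ne_zero_of_re_nonneg {p m : ℂ} (h : 0 ≤ (p * conj m).re) (hpm : p ≠ 0 ∨ m ≠ 0) :
    p + m ≠ 0 := by
  intro h0
  have h1 := Complex.normSq_add p m
  rw [h0, Complex.normSq_zero] at h1
  have h2 := Complex.normSq_nonneg p
  have h3 := Complex.normSq_nonneg m
  rcases hpm with hp | hp
  · have := Complex.normSq_pos.2 hp; linarith
  · have := Complex.normSq_pos.2 hp; linarith

/-- The factor `E/2` cancels between numerator and denominator, leaving a Cayley transform of the
pair `p/C₂`, `m/C₁`. -/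
theorem isInnerQuotient_add {M : ℝ} {φ ψ : ℝ → ℝ} (h1 : CondK1 E c Z)
    (h2 : CondK2 E c Z K) (h3 : CondK3 K) (hM : ∀ x, |K x| ≤ M * Real.exp (c * x))
    (hΘd : DifferentiableOn ℂ Θ {z : ℂ | 0 < z.im}) (hΘ1 : ∀ z : ℂ, 0 < z.im → ‖Θ z‖ ≤ 1)
    (hΘ : ∀ z : ℂ, c < z.im → Θ z = fourierIntegral K z)
    (hφ : IsBoundaryDensity K 1 t φ) (hψ : IsBoundaryDensity K (-1) t ψ) {F : ℂ → ℂ}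
    (hF : EqOn F (fun z => continuation E (-1) t ψ z + continuation E 1 t φ z) Zᶜ) :
    IsInnerQuotient Z F := by
  have hK := h2.continuous
  have hCC := leftValue_mul_leftValue hK h3 hM hφ hψ hΘ1 hΘ
  have hdet := edge_mul_edge_add hK h3 hM hφ hψ hΘ1 hΘ
  set C₁ := IsBoundaryDensity.leftValue t φ with hC₁
  set C₂ := IsBoundaryDensity.leftValue t ψ with hC₂
  have hC₁0 : (C₁ : ℂ) ≠ 0 := by exact_mod_cast left_ne_zero_of_mul_eq_one hCC
  have hC₂0 : (C₂ : ℂ) ≠ 0 := by exact_mod_cast right_ne_zero_of_mul_eq_one hCC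
  have hCCc : (C₁ : ℂ) * C₂ = 1 := by exact_mod_cast hCC
  set p : ℂ → ℂ := fun z => edge t ψ z + Θ z * edge t ψ (-z) with hp
  set m : ℂ → ℂ := fun z => edge t φ z - Θ z * edge t φ (-z) with hm
  have hwp : ∀ z, wave (-1) t ψ Θ z = p z := fun z => by simp [wave, hp]
  have hwm : ∀ z, wave 1 t φ Θ z = m z := fun z => by simp [wave, hm]
  set S : Set ℝ := {x : ℝ | (x : ℂ) ∈ Z ∪ {z | z ∉ Z ∧ E z = 0}} with hS
  have hSc : S.Countable :=
    (h1.countable.union (countable_zeros h1 h2.ne_zero)).preimage Complex.ofReal_injective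
  have hbd : ∀ x : ℝ, x ∉ S → ∃ u : ℂ, ‖u‖ = 1 ∧
      Tendsto Θ (𝓝[{z : ℂ | 0 < z.im}] (x : ℂ)) (𝓝 u) := fun x hx =>
    tendsto_schur h1 h2 hΘd hΘ (fun h => hx (Or.inl h))
      (fun h => hx (Or.inr ⟨fun h' => hx (Or.inl h'), h⟩))
  have hpos : ∀ z : ℂ, 0 < z.im → 0 ≤ (p z * conj (m z)).re := by
    obtain ⟨D₁, hD₁⟩ := hφ.exists_norm_wave_le hK h3 hM (by simp) hΘ1 hΘ
    obtain ⟨D₂, hD₂⟩ := hψ.exists_norm_wave_le hK h3 hM (by simp) hΘ1 hΘ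
    set G₁ := 1 + ∫ y in Iio t, |φ y|
    set G₂ := 1 + ∫ y in Iio t, |ψ y|
    set D := max (max D₁ D₂) (max G₁ G₂) with hD
    intro z hz
    refine re_mul_conj_nonneg (C := D) (t := t) hΘd hφ.differentiable_edge hψ.differentiable_edge
      (conj_edge t φ) (conj_edge t ψ) (fun w hw => ?_) (fun w hw => ?_) (fun w hw => ?_)
      (fun w hw => ?_) hdet hSc hbd hz
    · refine (hφ.norm_edge_neg_le hw.le).trans (mul_le_mul_of_nonneg_right ?_ (Real.exp_nonneg _))
      exact (le_max_left _ _).trans (le_max_right _ _)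
    · refine (hψ.norm_edge_neg_le hw.le).trans (mul_le_mul_of_nonneg_right ?_ (Real.exp_nonneg _))
      exact (le_max_right _ _).trans (le_max_right _ _)
    · have := hD₁ w hw
      rw [hwm] at this
      refine this.trans (mul_le_mul_of_nonneg_right ?_ (Real.exp_nonneg _))
      exact (le_max_left _ _).trans (le_max_left _ _)
    · have := hD₂ w hw
      rw [hwp] at this
      refine this.trans (mul_le_mul_of_nonneg_right ?_ (Real.exp_nonneg _))
      exact (le_max_right _ _).trans (le_max_left _ _)
  -- Normalising by `C₁` and `C₂` leaves `p m̄` unchanged, since these constants are real with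
  -- product `1`.
  have hpos' : ∀ z : ℂ, 0 < z.im → 0 ≤ ((p z / C₂) * conj (m z / C₁)).re := fun z hz => by
    have : (p z / C₂) * conj (m z / C₁) = p z * conj (m z) := by
      rw [map_div₀, Complex.conj_ofReal]
      field_simp
      linear_combination (-(p z * conj (m z))) * hCCc
    rw [this]
    exact hpos z hz
  -- The sum could vanish only where `p` and `m` both vanish, and then the determinant would be `0`
  -- instead of `2`.
  have hnz : ∀ z : ℂ, 0 < z.im → p z / C₂ + m z / C₁ ≠ 0 := fun z hz => by
    refine add_ne_zero_of_re_nonneg (hpos' z hz) ?_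
    by_contra! hcon
    obtain ⟨c1, c2⟩ := hcon
    have c1' : p z = 0 := by simpa [hC₂0] using c1
    have c2' : m z = 0 := by simpa [hC₁0] using c2
    have : (0 : ℂ) = 2 := by
      rw [← hdet z]
      simp only [hp, hm] at c1' c2'
      linear_combination (-edge t φ (-z)) * c1' - edge t ψ (-z) * c2'
    norm_num at this
  have hFeq : ∀ z : ℂ, 0 < z.im → z ∉ Z → F z = E z / 2 * (p z / C₂ + m z / C₁) :=
    fun z hz hzZ => by
      rw [hF hzZ]
      simp only
      rw [continuation_eq_wave h1 h2 hΘd hΘ hz hzZ,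
        continuation_eq_wave h1 h2 hΘd hΘ hz hzZ, hwp, hwm, mul_add]
  have hsharp : ∀ z : ℂ, 0 < z.im → z ∉ Z → sharp F z = E z / 2 * (p z / C₂ - m z / C₁) :=
    fun z hz hzZ => by
      unfold sharp
      rw [hF (h1.conj_notMem hzZ)]
      simp only
      rw [map_add, sharp_continuation (by norm_num) h1 hzZ, sharp_continuation (by norm_num) h1 hzZ,
        continuation_eq_wave h1 h2 hΘd hΘ hz hzZ,
        continuation_eq_wave h1 h2 hΘd hΘ hz hzZ, hwp, hwm]
      push_cast
      ring
  refine ⟨?_, fun z => (p z / C₂ - m z / C₁) / (p z / C₂ + m z / C₁), ⟨?_, ⟨1, fun z hz => ?_⟩, ?_⟩,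
    fun z hz hzZ hFz => ?_⟩
  · obtain ⟨z, hz, hEz⟩ := exists_ne_zero_above h1 h2.ne_zero
    have hz0 := h1.c_pos.trans hz
    refine ⟨z, hz0, h1.notMem_of_lt hz, ?_⟩
    rw [hFeq z hz0 (h1.notMem_of_lt hz)]
    exact mul_ne_zero (div_ne_zero hEz two_ne_zero) (hnz z hz0)
  · have hpd : DifferentiableOn ℂ p {z : ℂ | 0 < z.im} :=
      hψ.differentiable_edge.differentiableOn.add
        (hΘd.mul (hψ.differentiable_edge.comp differentiable_neg).differentiableOn)
    have hmd : DifferentiableOn ℂ m {z : ℂ | 0 < z.im} :=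
      hφ.differentiable_edge.differentiableOn.sub
        (hΘd.mul (hφ.differentiable_edge.comp differentiable_neg).differentiableOn)
    exact (((hpd.div_const _).sub (hmd.div_const _)).div
      ((hpd.div_const _).add (hmd.div_const _)) hnz).analyticOnNhd (isOpen_im_gt 0)
  · rw [norm_div]
    exact div_le_one_of_le₀ (norm_sub_le_norm_add_of_re_nonneg (hpos' z hz)) (norm_nonneg _)
  · filter_upwards [hSc.ae_notMem volume] with x hx
    obtain ⟨u, hu, hlim⟩ := hbd x hx
    have hy : Tendsto (fun y : ℝ => (x : ℂ) + y * Complex.I) (𝓝[>] 0)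
        (𝓝[{z : ℂ | 0 < z.im}] (x : ℂ)) := by
      refine tendsto_nhdsWithin_iff.2 ⟨?_, ?_⟩
      · have : Continuous fun y : ℝ => (x : ℂ) + y * Complex.I := by fun_prop
        have := (this.tendsto 0).mono_left (nhdsWithin_le_nhds (s := Ioi 0))
        simpa using this
      · filter_upwards [self_mem_nhdsWithin] with y hy
        simpa using hy
    have lq : ∀ {χ : ℝ → ℝ}, Differentiable ℂ (edge t χ) →
        Tendsto (edge t χ) (𝓝[{z : ℂ | 0 < z.im}] (x : ℂ)) (𝓝 (edge t χ x)) ∧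
        Tendsto (fun z => edge t χ (-z)) (𝓝[{z : ℂ | 0 < z.im}] (x : ℂ)) (𝓝 (edge t χ (-x))) :=
      fun hχ => ⟨hχ.continuous.continuousWithinAt,
        (hχ.comp differentiable_neg).continuous.continuousWithinAt⟩
    obtain ⟨l1, l2⟩ := lq hφ.differentiable_edge
    obtain ⟨l3, l4⟩ := lq hψ.differentiable_edge
    have lp : Tendsto p _ (𝓝 (edge t ψ x + u * edge t ψ (-x))) := l3.add (hlim.mul l4)
    have lm : Tendsto m _ (𝓝 (edge t φ x - u * edge t φ (-x))) := l1.sub (hlim.mul l2)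
    set p₀ := edge t ψ x + u * edge t ψ (-x) with hp₀
    set m₀ := edge t φ x - u * edge t φ (-x) with hm₀
    have huu : u * conj u = 1 := by
      rw [Complex.mul_conj, Complex.normSq_eq_norm_sq, hu]; simp
    have cφ : conj (edge t φ x) = edge t φ (-x) := by simpa using conj_edge t φ x
    have cψ : conj (edge t ψ x) = edge t ψ (-x) := by simpa using conj_edge t ψ x
    have cφ' : conj (edge t φ (-x)) = edge t φ x := by rw [← cφ, Complex.conj_conj]
    have cψ' : conj (edge t ψ (-x)) = edge t ψ x := by rw [← cψ, Complex.conj_conj]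
    -- At the boundary `u p̄₀ = p₀` and `u m̄₀ = -m₀`, so `p₀ m̄₀` is purely imaginary and sum and
    -- difference have the same modulus.
    have hp₀c : u * conj p₀ = p₀ := by
      simp only [hp₀, map_add, map_mul, cψ, cψ']
      linear_combination edge t ψ x * huu
    have hm₀c : u * conj m₀ = -m₀ := by
      simp only [hm₀, map_sub, map_mul, cφ, cφ']
      linear_combination (-edge t φ x) * huu
    have hu0 : u ≠ 0 := by rintro rfl; simp at hu
    have hre : ((p₀ / C₂) * conj (m₀ / C₁)).re = 0 := by
      have e1 : p₀ * conj m₀ + conj p₀ * m₀ = 0 := by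
        apply mul_left_cancel₀ hu0
        linear_combination p₀ * hm₀c + m₀ * hp₀c
      have e2 : (p₀ / C₂) * conj (m₀ / C₁) = p₀ * conj m₀ := by
        rw [map_div₀, Complex.conj_ofReal]
        field_simp
        linear_combination (-(p₀ * conj m₀)) * hCCc
      have e3 : ((2 * (p₀ * conj m₀).re : ℝ) : ℂ) = 0 := by
        rw [← Complex.add_conj, map_mul, Complex.conj_conj, e1]
      rw [e2]
      have : 2 * (p₀ * conj m₀).re = 0 := by exact_mod_cast e3
      linarith
    have hsum : p₀ / C₂ + m₀ / C₁ ≠ 0 := by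
      refine add_ne_zero_of_re_nonneg hre.ge ?_
      by_contra! hcon
      obtain ⟨c1, c2⟩ := hcon
      have c1' : p₀ = 0 := by simpa [hC₂0] using c1
      have c2' : m₀ = 0 := by simpa [hC₁0] using c2
      have : (0 : ℂ) = 2 := by
        rw [← hdet x]
        simp only [hp₀, hm₀] at c1' c2'
        linear_combination (-edge t φ (-x)) * c1' - edge t ψ (-x) * c2'
      norm_num at this
    have hnorm : ‖(p₀ / C₂ - m₀ / C₁) / (p₀ / C₂ + m₀ / C₁)‖ = 1 := by
      have h4 : ‖p₀ / C₂ - m₀ / C₁‖ = ‖p₀ / C₂ + m₀ / C₁‖ := by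
        refine le_antisymm (norm_sub_le_norm_add_of_re_nonneg hre.ge) ?_
        have h5 := norm_sub_le_norm_add_of_re_nonneg (p := p₀ / C₂) (m := -(m₀ / C₁))
          (by rw [map_neg, mul_neg, Complex.neg_re, hre, neg_zero])
        rwa [sub_neg_eq_add, ← sub_eq_add_neg] at h5
      rw [norm_div, h4, div_self (norm_ne_zero_iff.2 hsum)]
    rw [← hnorm]
    have lθ := ((lp.div_const (C₂ : ℂ)).sub (lm.div_const (C₁ : ℂ))).div
      ((lp.div_const (C₂ : ℂ)).add (lm.div_const (C₁ : ℂ))) hsum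
    exact (lθ.comp hy).norm
  · rw [hFeq z hz hzZ] at hFz ⊢
    rw [hsharp z hz hzZ, mul_div_mul_left _ _ (left_ne_zero_of_mul hFz)]

end Final

end InnerFamily

end

theorem mainTheorem7 (E : ℂ → ℂ) (c : ℝ) (Z : Set ℂ) (K : ℝ → ℝ)
    (h1 : InnerFamily.CondK1 E c Z) (h2 : InnerFamily.CondK2 E c Z K)
    (h3 : InnerFamily.CondK3 K) (h4 : InnerFamily.CondK4 K)
    (h5 : InnerFamily.CondK5 K ⊤) (t : ℝ) :
    (∃! Φ : ℝ → ℂ, InnerFamily.SolvesIntegralEq K 1 t Φ) ∧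
    (∃! Ψ : ℝ → ℂ, InnerFamily.SolvesIntegralEq K (-1) t Ψ) ∧
    ∀ Φ Ψ : ℝ → ℂ, InnerFamily.SolvesIntegralEq K 1 t Φ →
      InnerFamily.SolvesIntegralEq K (-1) t Ψ →
      (∀ z : ℂ, c < z.im →
        IntegrableOn (fun x : ℝ => Φ x * Complex.exp (Complex.I * z * x)) (Ioi t) ∧
        IntegrableOn (fun x : ℝ => Ψ x * Complex.exp (Complex.I * z * x)) (Ioi t)) ∧
      (∃ A : ℂ → ℂ,
        InnerFamily.IsContinuation c Z (InnerFamily.halfLineTransform E t Ψ) A) ∧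
      (∃ B : ℂ → ℂ,
        InnerFamily.IsContinuation c Z
          (fun z => Complex.I * InnerFamily.halfLineTransform E t Φ z) B) ∧
      ∀ A B : ℂ → ℂ,
        InnerFamily.IsContinuation c Z (InnerFamily.halfLineTransform E t Ψ) A →
        InnerFamily.IsContinuation c Z
          (fun z => Complex.I * InnerFamily.halfLineTransform E t Φ z) B →
        InnerFamily.IsInnerQuotient Z (fun z => A z - Complex.I * B z) := by
  have hK := h2.continuous
  obtain ⟨M, -, hM⟩ := InnerFamily.exists_exp_bound_of_condK3 h1.c_pos.le hK h2.growth h3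
  obtain ⟨Θ, hΘd, hΘ1, hΘ⟩ := InnerFamily.exists_schur_extension h1.c_pos hK h3 h5 hM
  obtain ⟨φ, hφ⟩ := InnerFamily.exists_isBoundaryDensity hK h3 h5 (σ := 1) (by simp) t
  obtain ⟨ψ, hψ⟩ := InnerFamily.exists_isBoundaryDensity hK h3 h5 (σ := -1) (by simp) t
  obtain ⟨B₁, -, hB₁⟩ := hφ.exists_growth (by simp) hM
  obtain ⟨B₂, -, hB₂⟩ := hψ.exists_growth (by simp) hM
  have hCC := InnerFamily.leftValue_mul_leftValue hK h3 hM hφ hψ hΘ1 hΘ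
  have hsφ := hφ.solvesIntegralEq hK h3 (left_ne_zero_of_mul_eq_one hCC)
  have hsψ := hψ.solvesIntegralEq hK h3 (right_ne_zero_of_mul_eq_one hCC)
  rw [Complex.ofReal_one] at hsφ
  rw [Complex.ofReal_neg, Complex.ofReal_one] at hsψ
  refine ⟨⟨_, hsφ, fun f hf => InnerFamily.solvesIntegralEq_unique hK h3 h5 (Or.inl rfl) hf hsφ⟩,
    ⟨_, hsψ, fun f hf => InnerFamily.solvesIntegralEq_unique hK h3 h5 (Or.inr rfl) hf hsψ⟩, ?_⟩
  intro Φ Ψ hΦ hΨ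
  -- Uniqueness lets arbitrary solutions be replaced by the normalised primitives.
  obtain rfl := InnerFamily.solvesIntegralEq_unique hK h3 h5 (Or.inl rfl) hΦ hsφ
  obtain rfl := InnerFamily.solvesIntegralEq_unique hK h3 h5 (Or.inr rfl) hΨ hsψ
  have hcontψ : InnerFamily.IsContinuation c Z (InnerFamily.halfLineTransform E t _)
      (InnerFamily.continuation E (-1) t ψ) :=
    ⟨InnerFamily.analytic_continuation h1 hψ, fun z hz =>
      InnerFamily.continuation_eq_halfLineTransform h1 h2 h3 hM hΘd hΘ hψ hB₂ hz⟩
  have hcontφ : InnerFamily.IsContinuation c Z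
      (fun z => Complex.I * InnerFamily.halfLineTransform E t _ z)
      (fun z => Complex.I * InnerFamily.continuation E 1 t φ z) :=
    ⟨fun z hz => analyticAt_const.mul (InnerFamily.analytic_continuation h1 hφ z hz), fun z hz => by
      simp only
      rw [InnerFamily.continuation_eq_halfLineTransform h1 h2 h3 hM hΘd hΘ hφ hB₁ hz]⟩
  refine ⟨fun z hz => ⟨?_, ?_⟩, ⟨_, hcontψ⟩, ⟨_, hcontφ⟩, fun A B hA hB => ?_⟩
  · refine ((hφ.integrableOn_primitive h1.c_pos hB₁ hz).div_const
      (InnerFamily.IsBoundaryDensity.leftValue t φ : ℂ)).congr (ae_of_all _ fun x => ?_)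
    push_cast
    ring
  · refine ((hψ.integrableOn_primitive h1.c_pos hB₂ hz).div_const
      (InnerFamily.IsBoundaryDensity.leftValue t ψ : ℂ)).congr (ae_of_all _ fun x => ?_)
    push_cast
    ring
  -- Continuations are unique because the complement of `Z` is connected, so the arbitrary `A` and
  -- `B` agree there with the explicit ones.
  · have huniq : ∀ {g G₁ G₂ : ℂ → ℂ}, InnerFamily.IsContinuation c Z g G₁ →
        InnerFamily.IsContinuation c Z g G₂ → EqOn G₁ G₂ Zᶜ := by
      intro g G₁ G₂ hG₁ hG₂
      have hmem : Complex.I * ((c + 1 : ℝ) : ℂ) ∈ {z : ℂ | c < z.im} := by simp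
      refine hG₁.1.eqOn_of_preconnected_of_eventuallyEq hG₂.1 h1.isPreconnected_compl
        (z₀ := Complex.I * ((c + 1 : ℝ) : ℂ)) (h1.notMem_of_lt hmem) ?_
      filter_upwards [(InnerFamily.isOpen_im_gt c).mem_nhds hmem] with w hw
      rw [hG₁.2 w hw, hG₂.2 w hw]
    refine InnerFamily.isInnerQuotient_add h1 h2 h3 hM hΘd hΘ1 hΘ hφ hψ fun z hz => ?_
    simp only
    rw [huniq hA hcontψ hz, huniq hB hcontφ hz, ← mul_assoc, Complex.I_mul_I]
    ring
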